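/- Let $n\ge 0$ be an integer, and let $x$ denote an $n\times n$ matrix with real (or complex) entries. For nonempty $I,J\subseteq\{1,\dots,n\}$ with $|I|=|J|$, let $\Delta_{I,J}(x)$ be the minor with row set $I$ and column set $J$. The matrix $x$ is \emph{totally positive} if all its minors are positive real numbers. A \emph{double wiring diagram} consists of two families, light and dark, of $n$ piecewise-straight lines each, running from left to right, such that each pair of distinct lines of the same colour intersects exactly once. At each moment the lines of one colour occupy the levels $1,\dots,n$ (counted from the bottom), and an intersection of height $i$, $1\le i\le n-1$, of two lines of that colour exchanges the lines at the levels $i$ and $i+1$; so the diagram is recorded by the list of the colours and heights of its intersections, read from left to right. At the left end the dark lines are numbered $1,\dots,n$ and the light lines $n,\dots,1$ from bottom to top. For $1\le k\le n$, a chamber at level $k$ has exactly $k$ lines of each colour below it, and it stretches between consecutive intersections (of either colour) of height $k$, or between such an intersection and an end of the diagram, or from end to end if there are none. If $I$ is the set of the light lines and $J$ the set of the dark lines that pass below a chamber, then $\Delta_{I,J}$ is the \emph{chamber minor} of that chamber. \textbf{Theorem.} (1) Every double wiring diagram has exactly $n^2$ chambers, their chamber minors $\Delta_{I,J}$ are pairwise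 distinct (that is, the pairs $(I,J)$ are), and an $n\times n$ matrix is totally positive if and only if all these $n^2$ chamber minors are positive. (2) These criteria are optimal: if $S$ is a set of pairs $(I,J)$ of nonempty sets with $|I|=|J|$ such that an $n\times n$ matrix $x$ is totally positive if and only if $\Delta_{I,J}(x)>0$ for all $(I,J)\in S$, then $|S|\ge n^2$. (3) The initial-minor criterion is one of them: there is a double wiring diagram in which first all the light intersections and then all the dark ones take place, in both cases at the heights $1;\ 2,1;\ 3,2,1;\ \dots;\ n-1,\dots,2,1$, and its chamber minors are exactly the initial minors, i.e. the minors $\Delta_{I,J}$ such that $I$ and $J$ each consist of consecutive indices and $1\in I\cup J$. -/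

import Mathlib

open scoped ComplexOrder

namespace TotalPositivity

/-! ### Minors and total positivity -/

/-- The row set `I` and the column set `J` index a minor: they are nonempty and have the same
number of elements. -/
def IsMinorIndex {n : ℕ} (I J : Finset (Fin n)) : Prop :=
  I.Nonempty ∧ I.card = J.card

/-- The minor `Δ_{I,J}(x)` with row set `I` and column set `J`, the rows and the columns being taken
in increasing order. (It is only used for `I.card = J.card`; otherwise it is `0` by convention.) -/
noncomputable def minor {𝕜 : Type*} [CommRing 𝕜] {n : ℕ} (x : Matrix (Fin n) (Fin n) 𝕜)
    (I J : Finset (Fin n)) : 𝕜 :=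
  if h : J.card = I.card then
    (x.submatrix (I.orderEmbOfFin rfl) (J.orderEmbOfFin h)).det
  else 0

/-- A real or complex matrix is totally positive if all its minors are positive real numbers.
In the order on `𝕜` used here, `0 < z` says that `z` is a positive real number. -/
def IsTotallyPositive {𝕜 : Type*} [RCLike 𝕜] {n : ℕ} (x : Matrix (Fin n) (Fin n) 𝕜) : Prop :=
  ∀ I J : Finset (Fin n), IsMinorIndex I J → 0 < minor x I J

/-- The minor `Δ_{I,J}` is initial: `I` and `J` each consist of several consecutive indices, and
`I ∪ J` contains the first index. -/
def IsInitial {n : ℕ} (I J : Finset (Fin n)) : Prop :=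
  IsMinorIndex I J ∧ (∃ a b : Fin n, I = Finset.Icc a b) ∧ (∃ a b : Fin n, J = Finset.Icc a b) ∧
    ∃ i ∈ I ∪ J, (i : ℕ) = 0

/-! ### Double wiring diagrams -/

/-- The two colours of the lines of a double wiring diagram. -/
inductive Colour
  | light
  | dark
  deriving DecidableEq

/-- An intersection of two lines of the same colour. It takes place between two adjacent levels:
`pos = i` (with `0 ≤ i < n - 1`) is the intersection of height `i + 1`, at which the lines of
that colour at the levels `i + 1` and `i + 2` (counted from the bottom, starting from `1`) change
places. -/
structure Crossing (n : ℕ) where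
  colour : Colour
  pos : Fin (n - 1)

namespace Crossing

variable {n : ℕ}

/-- The height of an intersection, one of the numbers `1, …, n - 1`. -/
def height (c : Crossing n) : ℕ := c.pos + 1

/-- The lower of the two levels involved in an intersection (levels are counted from `0` here). -/
def lower (c : Crossing n) : Fin n := ⟨c.pos, by have := c.pos.isLt; omega⟩

/-- The upper of the two levels involved in an intersection (levels are counted from `0` here). -/
def upper (c : Crossing n) : Fin n := ⟨c.pos + 1, by have := c.pos.isLt; omega⟩

end Crossing

/-- The numbering of the lines at the left end, as a map from levels to lines: the dark lines
are numbered `1, …, n` from bottom to top, and the light lines `n, …, 1` from bottom to top. -/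
def startOrder (n : ℕ) : Colour → Equiv.Perm (Fin n)
  | .light => Fin.revPerm
  | .dark => 1

/-- Tracing the lines from left to right: `lineAt w a t` maps each level to the line of colour `a`
that runs at this level right after the first `t` intersections of the list `w`. -/
def lineAt {n : ℕ} (w : List (Crossing n)) (a : Colour) (t : ℕ) : Equiv.Perm (Fin n) :=
  (w.take t).foldl
    (fun σ c => if c.colour = a then σ * Equiv.swap c.lower c.upper else σ) (startOrder n a)

/-- The unordered pair of lines (of the colour of the intersection) that meet at the intersection
number `t` of the list `w`. -/
def crossedPair {n : ℕ} (w : List (Crossing n)) (t : Fin w.length) : Sym2 (Fin n) :=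
  s(lineAt w w[t].colour t w[t].lower, lineAt w w[t].colour t w[t].upper)

/-- A double wiring diagram: two families (light and dark) of `n` lines each, recorded by
the list of the intersections of lines of like colour from left to right. Each pair of
distinct lines of like colour intersects exactly once. -/
structure DoubleWiringDiagram (n : ℕ) where
  crossings : List (Crossing n)
  meet_once : ∀ (a : Colour) (p q : Fin n), p ≠ q →
    ∃! t : Fin crossings.length, crossings[t].colour = a ∧ crossedPair crossings t = s(p, q)

namespace DoubleWiringDiagram

variable {n : ℕ} (D : DoubleWiringDiagram n)

/-- The lines of colour `a` on the lowest `k` levels right after the first `t` intersections. -/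
def below (a : Colour) (k t : ℕ) : Finset (Fin n) :=
  (Finset.univ.filter fun i : Fin n => (i : ℕ) < k).image (lineAt D.crossings a t)

/-- The chambers of a double wiring diagram (except the one below all lines, to which no minor is
attached). A chamber with exactly `k` lines of each colour below it, `1 ≤ k ≤ n`, stretches between
two consecutive intersections (of any colour) at height `k`, or between such an intersection and an
end of the diagram. It is represented by `(k, t)`, where `t` is the number of intersections (at
any height) up to and including its left end; so `t = 0` if the chamber is open to the left, and
otherwise the intersection number `t` is at height `k`. -/
def chambers : Finset (ℕ × ℕ) :=
  (Finset.Icc 1 n ×ˢ Finset.range (D.crossings.length + 1)).filter fun c =>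
    c.2 = 0 ∨ (D.crossings[c.2 - 1]?).map Crossing.height = some c.1

/-- The pair of sets written into a chamber: the light lines and the dark lines that
pass below it. -/
def label (c : ℕ × ℕ) : Finset (Fin n) × Finset (Fin n) :=
  (D.below .light c.1 c.2, D.below .dark c.1 c.2)

/-- The chamber minors `Δ_{I,J}`, as pairs `(I, J)`: rows `I` from the light lines and columns `J`
from the dark lines that pass below the chamber. -/
def chamberMinors : Finset (Finset (Fin n) × Finset (Fin n)) :=
  D.chambers.image D.label

end DoubleWiringDiagram

/-- The sequence of heights `1, 2 1, 3 2 1, …, (n-1) ⋯ 2 1` (given by the positions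
`height - 1`): the lexicographically minimal way to make each pair of `n` lines intersect once. -/
def lexMinPositions (n : ℕ) : List (Fin (n - 1)) :=
  (List.finRange (n - 1)).flatMap fun m => ((List.finRange (n - 1)).filter (· ≤ m)).reverse

/-- The intersections of the lexicographically minimal double wiring diagram: first all the light
ones, then all the dark ones, each at the heights `1, 2 1, 3 2 1, …, (n-1) ⋯ 2 1`. -/
def lexMinCrossings (n : ℕ) : List (Crossing n) :=
  (lexMinPositions n).map (Crossing.mk .light) ++ (lexMinPositions n).map (Crossing.mk .dark)

end TotalPositivity

namespace TotalPositivity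

/-! ### Minors and signs -/

section Minors

variable {R : Type*} [CommRing R] {n : ℕ}

/-! A state is a pair of permutations giving the light and the dark lines at each level, and it
makes visible one minor for each level. Since two lines of one colour meet only once, a double
wiring diagram is a path of states: each crossing meets two adjacent lines still in their initial
order (`Allowed`), and the path ends where no such crossing is left.

For the criterion, suppose that all minors visible along one path are positive. Two allowed
crossings out of the same state either are independent or involve three consecutive lines of one
colour. In each case the resulting square or hexagon can be closed. At most one minor is then new,
and a three-term relation writes its product with a positive minor as a sum of products of positive
minors. For crossings of opposite colours at the same height this is the row-and-column exchange
`minor_mul_minor_exchange`; for three lines of one colour it is `minor_mul_minor_rows`. Both follow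
from Sylvester's identity (`exists_sylvester`). A diamond-lemma induction on the length of the path
(`HasPosPath.step`) thus carries positivity along every allowed crossing. Allowed crossings reach
every state from the initial one (`state_induction`), and every pair of row and column sets of equal
size is visible in some state.

For the count, the crossings correspond to a colour together with an unordered pair of lines, so
there are n(n-1) of them; each closes one chamber on the left, and n more chambers are open to the
left. The labels differ because the sum of initial levels below level k strictly increases at every
crossing of height k.

For optimality, fewer than n² minors impose fewer than n² linear conditions over the field of two
elements on a sign pattern of the entries, if the product of the signs on each diagonal is
prescribed. So some pattern other than the all-positive one has positive diagonal products for all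
these minors. For large T the entries ±T^(ij) with these signs make all of them positive, although
an entry is negative.

For the initial minors, an explicit formula for the states of the lexicographically minimal diagram
shows that its n² chamber minors are initial. There are at most n² initial minors, so these are all.
-/

lemma minor_eq_det (x : Matrix (Fin n) (Fin n) R) {I J : Finset (Fin n)} {k : ℕ}
    (hI : I.card = k) (hJ : J.card = k) :
    minor x I J = (x.submatrix (I.orderEmbOfFin hI) (J.orderEmbOfFin hJ)).det := by
  subst hI
  simp [minor, hJ]

lemma minor_empty (x : Matrix (Fin n) (Fin n) R) : minor x ∅ ∅ = 1 := by
  rw [minor_eq_det x (k := 0) rfl rfl, Matrix.det_fin_zero]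

lemma minor_transpose (x : Matrix (Fin n) (Fin n) R) {I J : Finset (Fin n)}
    (h : I.card = J.card) : minor x.transpose J I = minor x I J := by
  rw [minor_eq_det x h rfl, minor_eq_det x.transpose rfl h, ← Matrix.det_transpose]
  rfl

/-- The sign of a sequence of indices, i.e. the sign of its Vandermonde determinant. -/
def vsign {k : ℕ} (f : Fin k → Fin n) : ℤ :=
  (Matrix.vandermonde fun i => ((f i : ℕ) : ℤ)).det.sign

/-- The sign of the permutation which sorts `a` into the sequence `f`. -/
def insertSign {k : ℕ} (f : Fin k → Fin n) (a : Fin n) : ℤ :=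
  (∏ i, (((f i : ℕ) : ℤ) - ((a : ℕ) : ℤ))).sign

lemma vsign_cons {k : ℕ} (f : Fin k → Fin n) (a : Fin n) :
    vsign (Fin.cons a f : Fin (k + 1) → Fin n) = insertSign f a * vsign f := by
  simp only [vsign, insertSign, Matrix.det_vandermonde, Fin.prod_univ_succ, Fin.prod_Ioi_zero,
    Fin.prod_Ioi_succ, Int.sign_mul, Fin.cons_zero, Fin.cons_succ]

/-- The additional factor b - a is positive. Hence the sign of inserting two ordered indices is the
product of the two single signs, which lets `exists_sylvester` absorb all signs into one matrix. -/
lemma insertSign_cons {k : ℕ} (f : Fin k → Fin n) (a b : Fin n) (h : a < b) :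
    insertSign (Fin.cons b f : Fin (k + 1) → Fin n) a = insertSign f a := by
  have : (((b : ℕ) : ℤ) - ((a : ℕ) : ℤ)).sign = 1 := by
    apply Int.sign_eq_one_of_pos
    have : (a : ℕ) < b := h
    omega
  simp only [insertSign, Fin.prod_univ_succ, Int.sign_mul, Fin.cons_zero, Fin.cons_succ, this,
    one_mul]

lemma vsign_strictMono {k : ℕ} {f : Fin k → Fin n} (hf : StrictMono f) : vsign f = 1 := by
  apply Int.sign_eq_one_of_pos
  rw [Matrix.det_vandermonde]
  refine Finset.prod_pos fun i _ => Finset.prod_pos fun j hj => ?_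
  have : (f i : ℕ) < f j := hf (Finset.mem_Ioi.1 hj)
  omega

lemma vsign_comp_perm {k : ℕ} {f : Fin k → Fin n} (hf : StrictMono f)
    (π : Equiv.Perm (Fin k)) : vsign (f ∘ π) = Equiv.Perm.sign π := by
  have h := Matrix.det_permute π (Matrix.vandermonde fun i => ((f i : ℕ) : ℤ))
  have h1 := vsign_strictMono hf
  simp only [vsign] at h1 ⊢
  have e : (Matrix.vandermonde fun i => ((f i : ℕ) : ℤ)).submatrix π id =
      Matrix.vandermonde fun i => (((f ∘ π) i : ℕ) : ℤ) := rfl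
  rw [← e, h, Int.sign_mul, h1, mul_one]
  rcases Int.units_eq_one_or (Equiv.Perm.sign π) with h | h <;> simp [h]

lemma insertSign_mul_self {k : ℕ} (f : Fin k → Fin n) (a : Fin n) (h : ∀ i, f i ≠ a) :
    insertSign f a * insertSign f a = 1 := by
  have : (∏ i, (((f i : ℕ) : ℤ) - ((a : ℕ) : ℤ))) ≠ 0 := by
    refine Finset.prod_ne_zero_iff.2 fun i _ h0 => h i (Fin.ext ?_)
    omega
  rcases lt_or_gt_of_ne this with h | h
  · simp [insertSign, Int.sign_eq_neg_one_of_neg h]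
  · simp [insertSign, Int.sign_eq_one_of_pos h]

lemma exists_perm_of_injective {k : ℕ} {f : Fin k → Fin n} (hf : Function.Injective f)
    {I : Finset (Fin n)} (hI : I.card = k) (hr : ∀ i, f i ∈ I) :
    ∃ π : Equiv.Perm (Fin k), f = I.orderEmbOfFin hI ∘ π := by
  refine ⟨Equiv.ofBijective (fun i => (I.orderIsoOfFin hI).symm ⟨f i, hr i⟩) ?_, ?_⟩
  · apply Finite.injective_iff_bijective.1
    intro i j h
    simpa [hf.eq_iff] using h
  · funext i
    simp [← Finset.coe_orderIsoOfFin_apply]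

/-- Sorting the rows and the columns costs the signs of the sorting permutations, and on injective
sequences these signs are `vsign`. -/
lemma det_submatrix_eq_minor (x : Matrix (Fin n) (Fin n) R) {k : ℕ} {f g : Fin k → Fin n}
    (hf : Function.Injective f) (hg : Function.Injective g) {I J : Finset (Fin n)}
    (hI : I.card = k) (hJ : J.card = k) (hfI : ∀ i, f i ∈ I) (hgJ : ∀ i, g i ∈ J) :
    (x.submatrix f g).det = vsign f * vsign g * minor x I J := by
  obtain ⟨π, rfl⟩ := exists_perm_of_injective hf hI hfI
  obtain ⟨ρ, rfl⟩ := exists_perm_of_injective hg hJ hgJ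
  rw [vsign_comp_perm (OrderEmbedding.strictMono _), vsign_comp_perm (OrderEmbedding.strictMono _),
    minor_eq_det x hI hJ]
  have e : x.submatrix (I.orderEmbOfFin hI ∘ π) (J.orderEmbOfFin hJ ∘ ρ) =
    ((x.submatrix (I.orderEmbOfFin hI) (J.orderEmbOfFin hJ)).submatrix π id).submatrix id ρ := rfl
  rw [e, Matrix.det_permute', Matrix.det_permute]
  ring

lemma minor_singleton (x : Matrix (Fin n) (Fin n) R) (i j : Fin n) :
    minor x {i} {j} = x i j := by
  rw [minor_eq_det x (k := 1) (by simp) (by simp), Matrix.det_fin_one]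
  simp

end Minors

/-! ### Sylvester's identity for one and two additional rows and columns -/

section Sylvester

variable {K : Type*} [Field K] {n : ℕ}

/-- The Schur complement of the submatrix with rows `f` and columns `g`. -/
noncomputable def schur (x : Matrix (Fin n) (Fin n) K) {k : ℕ} (f g : Fin k → Fin n) :
    Matrix (Fin n) (Fin n) K :=
  x - x.submatrix id g * (x.submatrix f g)⁻¹ * x.submatrix f id

lemma det_submatrix_sumElim (x : Matrix (Fin n) (Fin n) K) {k l : ℕ} (f g : Fin k → Fin n)
    (p q : Fin l → Fin n) (h : (x.submatrix f g).det ≠ 0) :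
    (x.submatrix (Sum.elim p f) (Sum.elim q g)).det =
      (x.submatrix f g).det * ((schur x f g).submatrix p q).det := by
  let _ := Matrix.invertibleOfIsUnitDet (x.submatrix f g) (isUnit_iff_ne_zero.2 h)
  have e : x.submatrix (Sum.elim p f) (Sum.elim q g) = Matrix.fromBlocks (x.submatrix p q)
      (x.submatrix p g) (x.submatrix f q) (x.submatrix f g) := by
    ext (i | i) (j | j) <;> rfl
  rw [e, Matrix.det_fromBlocks₂₂, Matrix.invOf_eq_nonsing_inv]
  rfl

lemma det_submatrix_cons (x : Matrix (Fin n) (Fin n) K) {k : ℕ} (f g : Fin k → Fin n)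
    (a c : Fin n) (h : (x.submatrix f g).det ≠ 0) :
    (x.submatrix (Fin.cons a f : Fin (k + 1) → Fin n)
      (Fin.cons c g : Fin (k + 1) → Fin n)).det = (x.submatrix f g).det * schur x f g a c := by
  have hb : Function.Bijective
      (Sum.elim (fun _ => 0) Fin.succ : Fin 1 ⊕ Fin k → Fin (k + 1)) := by
    refine (Fintype.bijective_iff_injective_and_card _).2 ⟨?_, by simp [add_comm]⟩
    rintro (i | i) (j | j) hij
    · rw [Subsingleton.elim i j]
    · simp [Fin.ext_iff] at hij
    · simp [Fin.ext_iff] at hij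
    · simpa using hij
  have := det_submatrix_sumElim x f g (fun _ : Fin 1 => a) (fun _ => c) h
  rw [Matrix.det_fin_one] at this
  rw [← Matrix.det_submatrix_equiv_self (Equiv.ofBijective _ hb)]
  refine Eq.trans (congrArg _ ?_) this
  ext (i | i) (j | j) <;> simp

lemma det_submatrix_cons_cons (x : Matrix (Fin n) (Fin n) K) {k : ℕ} (f g : Fin k → Fin n)
    (a b c d : Fin n) (h : (x.submatrix f g).det ≠ 0) :
    (x.submatrix (Fin.cons a (Fin.cons b f : Fin (k + 1) → Fin n) : Fin (k + 1 + 1) → Fin n)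
      (Fin.cons c (Fin.cons d g : Fin (k + 1) → Fin n) : Fin (k + 1 + 1) → Fin n)).det =
    (x.submatrix f g).det *
      (schur x f g a c * schur x f g b d - schur x f g a d * schur x f g b c) := by
  have hb : Function.Bijective
      (Sum.elim ![0, 1] (fun i => i.succ.succ) : Fin 2 ⊕ Fin k → Fin (k + 1 + 1)) := by
    refine (Fintype.bijective_iff_injective_and_card _).2 ⟨?_, by simp; ring⟩
    rintro (i | i) (j | j) hij
    · fin_cases i <;> fin_cases j <;> simp_all
    · fin_cases i <;> simp [Fin.ext_iff] at hij
    · fin_cases j <;> simp [Fin.ext_iff] at hij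
    · simpa using hij
  have := det_submatrix_sumElim x f g ![a, b] ![c, d] h
  rw [Matrix.det_fin_two] at this
  rw [← Matrix.det_submatrix_equiv_self (Equiv.ofBijective _ hb)]
  refine Eq.trans (congrArg _ ?_) this
  ext (i | i) (j | j)
  · fin_cases i <;> fin_cases j <;> rfl
  · fin_cases i <;> rfl
  · fin_cases j <;> rfl
  · rfl

/-- Sylvester's identity for sorted minors: the signs are absorbed into the rescaled
Schur complement `s`. -/
lemma exists_sylvester (x : Matrix (Fin n) (Fin n) K) {A B : Finset (Fin n)}
    (hAB : A.card = B.card) (h : minor x A B ≠ 0) :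
    ∃ s : Fin n → Fin n → K,
      (∀ a ∉ A, ∀ c ∉ B, minor x (insert a A) (insert c B) = minor x A B * s a c) ∧
      (∀ a ∉ A, ∀ b ∉ A, a < b → ∀ c ∉ B, ∀ d ∉ B, c < d →
        minor x (insert a (insert b A)) (insert c (insert d B)) =
          minor x A B * (s a c * s b d - s a d * s b c)) := by
  set f := A.orderEmbOfFin hAB with hf
  set g := B.orderEmbOfFin rfl with hg
  have hfA : ∀ i, f i ∈ A := A.orderEmbOfFin_mem _
  have hgB : ∀ i, g i ∈ B := B.orderEmbOfFin_mem _
  have hdet : minor x A B = (x.submatrix f g).det := minor_eq_det x hAB rfl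
  have hne : (x.submatrix f g).det ≠ 0 := hdet ▸ h
  have hvf : vsign f = 1 := vsign_strictMono f.strictMono
  have hvg : vsign g = 1 := vsign_strictMono g.strictMono
  have sq : ∀ {C : Finset (Fin n)} {k : ℕ} (u : Fin k → Fin n) (a : Fin n), a ∉ C → (∀ i, u i ∈ C) →
      ((insertSign u a : ℤ) : K) * insertSign u a = 1 := by
    intro C k u a ha hu
    rw [← Int.cast_mul, insertSign_mul_self u a fun i hi => ha (hi ▸ hu i), Int.cast_one]
  -- Each sign squares to 1, so rescaling the Schur complement by row and column signs turns
  -- determinants with the new indices in front into sorted minors.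
  refine ⟨fun a c => insertSign f a * insertSign g c * schur x f g a c, ?_, ?_⟩
  · intro a ha c hc
    have h1 := det_submatrix_cons x f g a c hne
    rw [det_submatrix_eq_minor x (I := insert a A) (J := insert c B)
      (Fin.cons_injective_iff.2 ⟨by rintro ⟨i, rfl⟩; exact ha (hfA i), f.injective⟩)
      (Fin.cons_injective_iff.2 ⟨by rintro ⟨i, rfl⟩; exact hc (hgB i), g.injective⟩)
      (by rw [Finset.card_insert_of_notMem ha, hAB]) (by rw [Finset.card_insert_of_notMem hc])
      (Fin.cases (by simp) fun i => by simp [hfA])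
      (Fin.cases (by simp) fun i => by simp [hgB]), vsign_cons, vsign_cons, hvf, hvg] at h1
    rw [hdet]
    have e1 := sq f a ha hfA
    have e2 := sq g c hc hgB
    push_cast at h1
    linear_combination (insertSign f a * insertSign g c : K) * h1 -
      minor x (insert a A) (insert c B) * (e1 * insertSign g c * insertSign g c + e2)
  · intro a ha b hb hab c hc d hd hcd
    have h1 := det_submatrix_cons_cons x f g a b c d hne
    have ha' : a ∉ insert b A := by simp [ha, hab.ne]
    have hc' : c ∉ insert d B := by simp [hc, hcd.ne]
    rw [det_submatrix_eq_minor x (I := insert a (insert b A)) (J := insert c (insert d B))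
      (Fin.cons_injective_iff.2 ⟨?_, Fin.cons_injective_iff.2 ⟨?_, f.injective⟩⟩)
      (Fin.cons_injective_iff.2 ⟨?_, Fin.cons_injective_iff.2 ⟨?_, g.injective⟩⟩)
      (by rw [Finset.card_insert_of_notMem ha', Finset.card_insert_of_notMem hb, hAB])
      (by rw [Finset.card_insert_of_notMem hc', Finset.card_insert_of_notMem hd])
      (Fin.cases (by simp) (Fin.cases (by simp) fun i => by simp [hfA]))
      (Fin.cases (by simp) (Fin.cases (by simp) fun i => by simp [hgB])),
      vsign_cons, vsign_cons, vsign_cons, vsign_cons, hvf, hvg, insertSign_cons _ _ _ hab,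
      insertSign_cons _ _ _ hcd] at h1
    · rw [hdet]
      have e1 := sq f a ha hfA
      have e2 := sq g c hc hgB
      have e3 := sq f b hb hfA
      have e4 := sq g d hd hgB
      push_cast at h1
      have e : (insertSign f a * insertSign g c * insertSign f b * insertSign g d : K) *
          (insertSign f a * insertSign g c * insertSign f b * insertSign g d : K) = 1 := by
        linear_combination e1 * insertSign g c * insertSign g c * insertSign f b * insertSign f b *
          insertSign g d * insertSign g d + e2 * insertSign f b * insertSign f b *
          insertSign g d * insertSign g d + e3 * insertSign g d * insertSign g d + e4
      linear_combination (insertSign f a * insertSign g c * insertSign f b * insertSign g d : K) *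
        h1 - minor x (insert a (insert b A)) (insert c (insert d B)) * e
    · rintro ⟨i, hi⟩
      revert hi
      refine Fin.cases (fun hi => ?_) (fun i hi => ?_) i
      · exact hab.ne hi.symm
      · exact ha (hi ▸ hfA i)
    · rintro ⟨i, rfl⟩; exact hb (hfA i)
    · rintro ⟨i, hi⟩
      revert hi
      refine Fin.cases (fun hi => ?_) (fun i hi => ?_) i
      · exact hcd.ne hi.symm
      · exact hc (hi ▸ hgB i)
    · rintro ⟨i, rfl⟩; exact hd (hgB i)

/-- The three-term relation for exchanging a row and a column. -/
lemma minor_mul_minor_exchange (x : Matrix (Fin n) (Fin n) K) {A B : Finset (Fin n)}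
    (hAB : A.card = B.card) (h : minor x A B ≠ 0) {a b c d : Fin n} (ha : a ∉ A) (hb : b ∉ A)
    (hab : a < b) (hc : c ∉ B) (hd : d ∉ B) (hcd : c < d) :
    minor x (insert a A) (insert c B) * minor x (insert b A) (insert d B) =
      minor x (insert a A) (insert d B) * minor x (insert b A) (insert c B) +
      minor x A B * minor x (insert a (insert b A)) (insert c (insert d B)) := by
  obtain ⟨s, h1, h2⟩ := exists_sylvester x hAB h
  rw [h1 a ha c hc, h1 b hb d hd, h1 a ha d hd, h1 b hb c hc, h2 a ha b hb hab c hc d hd hcd]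
  ring

/-- The three-term relation for three rows. -/
lemma minor_mul_minor_rows (x : Matrix (Fin n) (Fin n) K) {A B : Finset (Fin n)}
    (hAB : A.card = B.card) (h : minor x A B ≠ 0) {a b c u v : Fin n} (ha : a ∉ A) (hb : b ∉ A)
    (hc : c ∉ A) (hab : a < b) (hbc : b < c) (hu : u ∉ B) (hv : v ∉ B) (huv : u ≠ v) :
    minor x (insert b A) (insert u B) * minor x (insert a (insert c A)) (insert u (insert v B)) =
      minor x (insert a A) (insert u B) * minor x (insert b (insert c A)) (insert u (insert v B)) +
      minor x (insert c A) (insert u B) * minor x (insert a (insert b A)) (insert u (insert v B)) := by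
  obtain ⟨s, h1, h2⟩ := exists_sylvester x hAB h
  rcases lt_or_gt_of_ne huv with huv | huv
  · rw [h1 b hb u hu, h1 a ha u hu, h1 c hc u hu, h2 a ha c hc (hab.trans hbc) u hu v hv huv,
      h2 b hb c hc hbc u hu v hv huv, h2 a ha b hb hab u hu v hv huv]
    ring
  · rw [Finset.insert_comm u v, h1 b hb u hu, h1 a ha u hu, h1 c hc u hu,
      h2 a ha c hc (hab.trans hbc) v hv u hu huv, h2 b hb c hc hbc v hv u hu huv,
      h2 a ha b hb hab v hv u hu huv]
    ring

end Sylvester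

/-! ### Positivity transferred by the three-term relations -/

section Positivity

variable {𝕜 : Type*} [RCLike 𝕜] {n : ℕ}

lemma pos_of_mul_pos_of_pos {u v : 𝕜} (hu : 0 < u) (h : 0 < u * v) : 0 < v := by
  have h1 : 0 < u⁻¹ := RCLike.inv_pos.2 hu
  have h2 := mul_pos h1 h
  rwa [inv_mul_cancel_left₀ hu.ne'] at h2

lemma minor_pos_exchange (x : Matrix (Fin n) (Fin n) 𝕜) {A B : Finset (Fin n)}
    (hAB : A.card = B.card) {a b c d : Fin n} (ha : a ∉ A) (hb : b ∉ A)
    (hab : a < b) (hc : c ∉ B) (hd : d ∉ B) (hcd : c < d) (h : 0 < minor x A B)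
    (h2 : 0 < minor x (insert a (insert b A)) (insert c (insert d B)))
    (had : 0 < minor x (insert a A) (insert d B)) (hbc : 0 < minor x (insert b A) (insert c B)) :
    0 < minor x (insert a A) (insert c B) * minor x (insert b A) (insert d B) := by
  rw [minor_mul_minor_exchange x hAB h.ne' ha hb hab hc hd hcd]
  exact add_pos (mul_pos had hbc) (mul_pos h h2)

lemma minor_pos_rows (x : Matrix (Fin n) (Fin n) 𝕜) {A B : Finset (Fin n)}
    (hAB : A.card = B.card) {a b c u v : Fin n} (ha : a ∉ A) (hb : b ∉ A)
    (hc : c ∉ A) (habc : (a < b ∧ b < c) ∨ (c < b ∧ b < a)) (hu : u ∉ B) (hv : v ∉ B) (huv : u ≠ v)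
    (h : 0 < minor x A B) (h1 : 0 < minor x (insert a A) (insert u B))
    (h2 : 0 < minor x (insert c A) (insert u B))
    (h3 : 0 < minor x (insert b (insert a A)) (insert v (insert u B)))
    (h4 : 0 < minor x (insert c (insert b A)) (insert v (insert u B))) :
    0 < minor x (insert b A) (insert u B) * minor x (insert c (insert a A)) (insert v (insert u B))
    := by
  rw [Finset.insert_comm v u] at *
  rcases habc with ⟨hab, hbc⟩ | ⟨hcb, hba⟩
  · rw [Finset.insert_comm c a, minor_mul_minor_rows x hAB h.ne' ha hb hc hab hbc hu hv huv,
      Finset.insert_comm b c, Finset.insert_comm a b]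
    exact add_pos (mul_pos h1 h4) (mul_pos h2 h3)
  · rw [minor_mul_minor_rows x hAB h.ne' hc hb ha hcb hba hu hv huv]
    exact add_pos (mul_pos h2 h3) (mul_pos h1 h4)

end Positivity

/-! ### Optimality -/

section Optimality

/-- The strict rearrangement inequality: equality would force f ∘ σ to be increasing, hence σ = 1.
-/
lemma sum_mul_perm_lt {k : ℕ} {f g : Fin k → ℕ} (hf : StrictMono f) (hg : StrictMono g)
    (σ : Equiv.Perm (Fin k)) (hσ : σ ≠ 1) : ∑ i, f (σ i) * g i < ∑ i, f i * g i := by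
  have hfg : Monovary f g := hf.monotone.monovary hg.monotone
  have := hfg.sum_comp_perm_smul_lt_sum_smul_iff (σ := σ)
  simp only [smul_eq_mul] at this
  refine this.2 fun hm => hσ ?_
  have hmono : StrictMono (f ∘ σ) := by
    have : Monotone (f ∘ σ) := by
      intro i j hij
      rcases hij.eq_or_lt with rfl | hij
      · rfl
      · exact hm (hg hij)
    exact this.strictMono_of_injective (hf.injective.comp σ.injective)
  have hs : StrictMono σ := fun i j hij => hf.lt_iff_lt.1 (hmono hij)
  ext i
  have := StrictMono.range_inj (f := σ) (g := id) hs strictMono_id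
  simpa using congrArg Fin.val (congrFun (this.1 (by simp)) i)

/-- The matrix with entries `ε i j * T ^ (i * j)`. -/
def powMatrix {n : ℕ} (T : ℝ) (ε : Fin n → Fin n → ℝ) : Matrix (Fin n) (Fin n) ℝ :=
  fun i j => ε i j * T ^ ((i : ℕ) * (j : ℕ))

/-- For large `T`, the minors of `powMatrix T ε` have the sign of their diagonal term. -/
lemma powMatrix_minor_pos {n : ℕ} {T : ℝ} (hT : (n.factorial : ℝ) < T) {ε : Fin n → Fin n → ℝ}
    (hε : ∀ i j, |ε i j| = 1) {I J : Finset (Fin n)} {k : ℕ} (hI : I.card = k)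
    (hJ : J.card = k) (hd : ∏ i, ε (I.orderEmbOfFin hI i) (J.orderEmbOfFin hJ i) = 1) :
    0 < minor (powMatrix T ε) I J := by
  have hk : k ≤ n := by simpa [hJ] using Finset.card_le_univ J
  rw [minor_eq_det _ hI hJ]
  set f := I.orderEmbOfFin hI
  set g := J.orderEmbOfFin hJ
  have hT1 : 1 ≤ T := le_trans (by exact_mod_cast n.factorial_pos) hT.le
  set M := ∑ i, (f i : ℕ) * (g i : ℕ) with hM
  have hterm : ∀ σ : Equiv.Perm (Fin k), ∏ i, powMatrix T ε (f (σ i)) (g i) =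
      (∏ i, ε (f (σ i)) (g i)) * T ^ (∑ i, (f (σ i) : ℕ) * (g i : ℕ)) := by
    intro σ
    simp only [powMatrix, Finset.prod_mul_distrib, Finset.prod_pow_eq_pow_sum]
  have habs : ∀ σ : Equiv.Perm (Fin k), |∏ i, ε (f (σ i)) (g i)| = 1 := by
    intro σ
    rw [Finset.abs_prod]
    exact Finset.prod_eq_one fun i _ => hε _ _
  rw [Matrix.det_apply, ← Finset.add_sum_erase _ _ (Finset.mem_univ 1)]
  simp only [Matrix.submatrix_apply]
  have h1 : (Equiv.Perm.sign (1 : Equiv.Perm (Fin k))) •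
      ∏ i, powMatrix T ε (f ((1 : Equiv.Perm (Fin k)) i)) (g i) = T ^ M := by
    rw [hterm, Equiv.Perm.sign_one, one_smul]
    simp only [Equiv.Perm.one_apply, hd, one_mul, hM]
  have h2 : |∑ σ ∈ Finset.univ.erase (1 : Equiv.Perm (Fin k)),
      (Equiv.Perm.sign σ) • ∏ i, powMatrix T ε (f (σ i)) (g i)| < T ^ M := by
    -- If M = 0, no sum can be strictly smaller, so there is no nontrivial permutation. Otherwise
    -- each of the at most n! remaining terms is at most T^(M-1) in absolute value, and n! < T.
    rcases Nat.eq_zero_or_pos M with h0 | hpos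
    · rw [Finset.sum_eq_zero]
      · simp; positivity
      · intro σ hσ
        have := sum_mul_perm_lt (f := fun i => (f i : ℕ)) (g := fun i => (g i : ℕ))
          (fun i j h => f.strictMono h) (fun i j h => g.strictMono h) σ (Finset.ne_of_mem_erase hσ)
        omega
    · refine lt_of_le_of_lt (Finset.abs_sum_le_sum_abs _ _) ?_
      calc _ ≤ ∑ σ ∈ Finset.univ.erase (1 : Equiv.Perm (Fin k)), T ^ (M - 1) := by
            refine Finset.sum_le_sum fun σ hσ => ?_
            have := sum_mul_perm_lt (f := fun i => (f i : ℕ)) (g := fun i => (g i : ℕ))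
              (fun i j h => f.strictMono h) (fun i j h => g.strictMono h) σ
              (Finset.ne_of_mem_erase hσ)
            have h3 : |(Equiv.Perm.sign σ) • ∏ i, powMatrix T ε (f (σ i)) (g i)| =
                T ^ (∑ i, (f (σ i) : ℕ) * (g i : ℕ)) := by
              have : |(Equiv.Perm.sign σ) • ∏ i, powMatrix T ε (f (σ i)) (g i)| =
                  |∏ i, powMatrix T ε (f (σ i)) (g i)| := by
                rcases Int.units_eq_one_or (Equiv.Perm.sign σ) with h | h <;> simp [h]
              rw [this, hterm, abs_mul, habs, one_mul, abs_of_pos (by positivity)]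
            rw [h3]
            exact pow_le_pow_right₀ hT1 (by omega)
        _ ≤ n.factorial * T ^ (M - 1) := by
            rw [Finset.sum_const, nsmul_eq_mul]
            gcongr
            refine (Finset.card_le_univ _).trans ?_
            rw [Fintype.card_perm, Fintype.card_fin]
            exact Nat.factorial_le hk
        _ < T * T ^ (M - 1) := by gcongr
        _ = T ^ M := by rw [← pow_succ', Nat.sub_add_cancel hpos]
  rw [h1]
  have := (abs_lt.1 h2).1
  linarith

lemma minor_map_ofReal {𝕜 : Type*} [RCLike 𝕜] {n : ℕ} (x : Matrix (Fin n) (Fin n) ℝ)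
    (I J : Finset (Fin n)) : minor (x.map (RCLike.ofReal : ℝ → 𝕜)) I J =
      (RCLike.ofReal (minor x I J) : 𝕜) := by
  unfold minor
  split_ifs with h
  · have := RingHom.map_det (algebraMap ℝ 𝕜)
      (x.submatrix (I.orderEmbOfFin rfl) (J.orderEmbOfFin h))
    rw [RCLike.algebraMap_eq_ofReal] at this
    rw [this]
    rfl
  · simp

/-- Pigeonhole on sign patterns: the minors in S see a pattern only through its diagonal products,
one bit for each minor, so fewer than n² of them cannot separate all patterns. -/
theorem card_le_of_criterion {𝕜 : Type*} [RCLike 𝕜] {n : ℕ}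
    (S : Finset (Finset (Fin n) × Finset (Fin n)))
    (hS : ∀ p ∈ S, IsMinorIndex p.1 p.2)
    (hcrit : ∀ x : Matrix (Fin n) (Fin n) 𝕜,
      IsTotallyPositive x ↔ ∀ p ∈ S, 0 < minor x p.1 p.2) : n ^ 2 ≤ S.card := by
  by_contra! hlt
  -- Signs are written additively in `ZMod 2`; `φ` records the sign of the diagonal product of each
  -- minor in S.
  let φ : (Fin n → Fin n → ZMod 2) → (S → ZMod 2) := fun e p =>
    ∑ i, e (p.1.1.orderEmbOfFin (hS p.1 p.2).2 i) (p.1.2.orderEmbOfFin rfl i)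
  have hcard : Fintype.card (S → ZMod 2) < Fintype.card (Fin n → Fin n → ZMod 2) := by
    simp only [Fintype.card_pi, ZMod.card, Finset.prod_const, Finset.card_univ, Fintype.card_coe,
      Fintype.card_fin]
    rw [← pow_mul, ← sq]
    exact Nat.pow_lt_pow_right one_lt_two hlt
  obtain ⟨u, v, huv, hφ⟩ := Fintype.exists_ne_map_eq_of_card_lt φ hcard
  -- The quotient of the two patterns with equal diagonal products: all its diagonal products over S
  -- are 1, but it has an entry -1 because the patterns differ.
  let ε : Fin n → Fin n → ℝ := fun i j => if u i j = v i j then 1 else -1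
  have hz : ∀ a b c d : ZMod 2, (if a + c = b + d then (1 : ℝ) else -1) =
      (if a = b then (1 : ℝ) else -1) * (if c = d then (1 : ℝ) else -1) := by
    have : ∀ a b c d : ZMod 2, (a + c = b + d) ↔ (a = b ↔ c = d) := by decide
    intro a b c d
    by_cases h1 : a = b <;> by_cases h2 : c = d <;> simp [this, h1, h2]
  have hprod : ∀ (k : ℕ) (a b : Fin k → ZMod 2), ∏ i, (if a i = b i then (1 : ℝ) else -1) =
      if ∑ i, a i = ∑ i, b i then 1 else -1 := by
    intro k
    induction k with
    | zero => intro a b; simp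
    | succ k ih => intro a b; rw [Fin.prod_univ_succ, ih, Fin.sum_univ_succ, Fin.sum_univ_succ, hz]
  let T : ℝ := n.factorial + 1
  have hpos : ∀ p ∈ S, 0 < minor ((powMatrix T ε).map (RCLike.ofReal : ℝ → 𝕜)) p.1 p.2 := by
    intro p hp
    rw [minor_map_ofReal, RCLike.ofReal_pos]
    refine powMatrix_minor_pos (by simp [T]) ?_ (hS p hp).2 rfl ?_
    · intro i j
      simp only [ε]
      split_ifs <;> simp
    · rw [hprod, if_pos (congrFun hφ ⟨p, hp⟩)]
  have htp := (hcrit _).2 hpos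
  apply huv
  funext i j
  have h := htp {i} {j} ⟨by simp, by simp⟩
  rw [minor_map_ofReal, RCLike.ofReal_pos, minor_singleton, powMatrix] at h
  by_contra hne
  simp only [ε, if_neg hne] at h
  have : 0 < T ^ ((i : ℕ) * (j : ℕ)) := by positivity
  linarith

end Optimality

/-! ### States of a wiring diagram -/

section States

variable {n : ℕ}

/-- A state assigns to each colour the lines at the levels `0, …, n - 1`. -/
abbrev State (n : ℕ) := Colour → Equiv.Perm (Fin n)

/-- The state after an intersection. -/
def step (σ : State n) (c : Crossing n) : State n :=
  Function.update σ c.colour (σ c.colour * Equiv.swap c.lower c.upper)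

/-- The intersection takes place between two lines whose order is still the initial one. -/
def Allowed (σ : State n) (c : Crossing n) : Prop :=
  startOrder n c.colour (σ c.colour c.lower) < startOrder n c.colour (σ c.colour c.upper)

/-- The lines of colour `a` at the lowest `k` levels. -/
def lowest (σ : State n) (a : Colour) (k : ℕ) : Finset (Fin n) :=
  (Finset.univ.filter fun i : Fin n => (i : ℕ) < k).image (σ a)

/-- The other colour. -/
def Colour.other : Colour → Colour
  | .light => .dark
  | .dark => .light

lemma Colour.other_ne (a : Colour) : a.other ≠ a := by cases a <;> decide

lemma Colour.other_other (a : Colour) : a.other.other = a := by cases a <;> rfl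

lemma Colour.eq_other_of_ne {a b : Colour} (h : b ≠ a) : b = a.other := by
  cases a <;> cases b <;> simp_all [Colour.other]

lemma startOrder_symm (a : Colour) : (startOrder n a).symm = startOrder n a := by
  cases a <;> rfl

lemma Crossing.lower_ne_upper (c : Crossing n) : c.lower ≠ c.upper := by
  simp [Crossing.lower, Crossing.upper]

lemma Crossing.height_le (c : Crossing n) : c.height + 1 ≤ n := by
  have := c.pos.isLt
  simp only [Crossing.height]
  omega

lemma step_apply_self (σ : State n) (c : Crossing n) :
    step σ c c.colour = σ c.colour * Equiv.swap c.lower c.upper := by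
  simp [step]

lemma step_apply_of_ne (σ : State n) (c : Crossing n) {a : Colour} (h : a ≠ c.colour) :
    step σ c a = σ a := by
  simp [step, h]

lemma step_step (σ : State n) (c : Crossing n) : step (step σ c) c = σ := by
  funext a
  by_cases h : a = c.colour
  · subst h
    rw [step_apply_self, step_apply_self, mul_assoc, Equiv.swap_mul_self, mul_one]
  · rw [step_apply_of_ne _ _ h, step_apply_of_ne _ _ h]

lemma mem_lowest {σ : State n} {a : Colour} {k : ℕ} {i : Fin n} :
    σ a i ∈ lowest σ a k ↔ (i : ℕ) < k := by
  simp [lowest]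

lemma card_lowest (σ : State n) (a : Colour) {k : ℕ} (hk : k ≤ n) : (lowest σ a k).card = k := by
  rw [lowest, Finset.card_image_of_injective _ (σ a).injective, Fin.card_filter_val_lt,
    min_eq_right hk]

lemma lowest_zero (σ : State n) (a : Colour) : lowest σ a 0 = ∅ := by
  simp [lowest]

lemma lowest_succ (σ : State n) (a : Colour) (i : Fin n) :
    lowest σ a (i + 1) = insert (σ a i) (lowest σ a i) := by
  rw [lowest, lowest, ← Finset.image_insert]
  congr 1
  ext j
  simp only [Finset.mem_filter, Finset.mem_univ, true_and, Finset.mem_insert, Fin.ext_iff]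
  omega

lemma lowest_step_of_colour_ne (σ : State n) (c : Crossing n) {a : Colour} (k : ℕ)
    (h : a ≠ c.colour) : lowest (step σ c) a k = lowest σ a k := by
  rw [lowest, step_apply_of_ne _ _ h, lowest]

/-- For k different from the height, the two exchanged levels are both among the lowest k or both
above them. -/
lemma lowest_step_of_ne (σ : State n) (c : Crossing n) (a : Colour) {k : ℕ} (h : k ≠ c.height) :
    lowest (step σ c) a k = lowest σ a k := by
  by_cases ha : a = c.colour
  · subst ha
    rw [lowest, step_apply_self, lowest, Equiv.Perm.coe_mul, ← Finset.image_image]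
    congr 1
    ext j
    simp only [Finset.mem_image, Finset.mem_filter, Finset.mem_univ, true_and]
    have key : ∀ i : Fin n, (Equiv.swap c.lower c.upper i : ℕ) < k ↔ (i : ℕ) < k := by
      intro i
      simp only [Crossing.height] at h
      rw [Equiv.swap_apply_def]
      split_ifs with h1 h2
      · subst h1; simp only [Crossing.lower, Crossing.upper]; omega
      · subst h2; simp only [Crossing.lower, Crossing.upper]; omega
      · rfl
    constructor
    · rintro ⟨i, hi, rfl⟩
      exact (key i).2 hi
    · intro hj
      exact ⟨Equiv.swap c.lower c.upper j, (key j).2 hj, Equiv.swap_apply_self _ _ _⟩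
  · exact lowest_step_of_colour_ne σ c k ha

lemma lowest_height (σ : State n) (c : Crossing n) (a : Colour) :
    lowest σ a c.height = insert (σ a c.lower) (lowest σ a c.pos) :=
  lowest_succ σ a c.lower

lemma lowest_step_height (σ : State n) (c : Crossing n) :
    lowest (step σ c) c.colour c.height =
      insert (σ c.colour c.upper) (lowest σ c.colour c.pos) := by
  rw [lowest_height, lowest_step_of_ne _ _ _ (by simp [Crossing.height]), step_apply_self]
  simp

/-- No level lies between the two that are exchanged, so only the meeting pair changes its relative
order. -/
lemma symm_lt_step_iff (σ : State n) (c : Crossing n) {a : Colour} {p q : Fin n} (hpq : p ≠ q)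
    (h : ¬ (c.colour = a ∧ s(σ a c.lower, σ a c.upper) = s(p, q))) :
    (step σ c a).symm p < (step σ c a).symm q ↔ (σ a).symm p < (σ a).symm q := by
  by_cases ha : a = c.colour
  · subst ha
    obtain ⟨i, rfl⟩ := (σ c.colour).surjective p
    obtain ⟨j, rfl⟩ := (σ c.colour).surjective q
    have hij : i ≠ j := fun h => hpq (by rw [h])
    have h' : ¬ ((c.lower = i ∧ c.upper = j) ∨ (c.lower = j ∧ c.upper = i)) := by
      simpa using h
    have e : ∀ i, (step σ c c.colour).symm (σ c.colour i) = Equiv.swap c.lower c.upper i := by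
      intro i
      rw [step_apply_self, Equiv.symm_apply_eq]
      simp
    rw [e, e, Equiv.symm_apply_apply, Equiv.symm_apply_apply, Equiv.swap_apply_def,
      Equiv.swap_apply_def]
    simp only [Crossing.lower, Crossing.upper, Fin.ext_iff] at h' hij ⊢
    simp only [Fin.lt_def]
    split_ifs <;> simp <;> omega
  · rw [step_apply_of_ne _ _ ha]

/-- The pairs of lines that are not in their initial order. -/
def inversions (σ : State n) : Finset (Colour × Fin n × Fin n) :=
  ({.light, .dark} ×ˢ Finset.univ).filter fun p =>
    startOrder n p.1 p.2.1 < startOrder n p.1 p.2.2 ∧ (σ p.1).symm p.2.2 < (σ p.1).symm p.2.1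

lemma mem_inversions {σ : State n} {a : Colour} {p q : Fin n} :
    (a, p, q) ∈ inversions σ ↔
      startOrder n a p < startOrder n a q ∧ (σ a).symm q < (σ a).symm p := by
  cases a <;> simp [inversions]

lemma symm_lower_lt_symm_upper (σ : State n) (c : Crossing n) :
    (σ c.colour).symm (σ c.colour c.lower) < (σ c.colour).symm (σ c.colour c.upper) := by
  simp [Crossing.lower, Crossing.upper]

lemma step_symm_upper_lt (σ : State n) (c : Crossing n) :
    (step σ c c.colour).symm (σ c.colour c.upper) <
      (step σ c c.colour).symm (σ c.colour c.lower) := by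
  have := symm_lower_lt_symm_upper (step σ c) c
  rw [step_apply_self] at this ⊢
  simpa using this

/-- The meeting pair was in its initial order and becomes a new inversion; every other pair keeps
its order. This supplies the measure for `state_induction`. -/
lemma inversions_ssubset_step {σ : State n} {c : Crossing n} (h : Allowed σ c) :
    inversions σ ⊂ inversions (step σ c) := by
  refine Finset.ssubset_iff_subset_ne.2 ⟨?_, ?_⟩
  · rintro ⟨a, p, q⟩ hp
    rw [mem_inversions] at hp ⊢
    refine ⟨hp.1, (symm_lt_step_iff σ c ?_ ?_).2 hp.2⟩
    · rintro rfl
      exact lt_irrefl _ hp.1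
    · rintro ⟨rfl, hs⟩
      rcases Sym2.eq_iff.1 hs with ⟨rfl, rfl⟩ | ⟨rfl, rfl⟩
      · exact lt_asymm h hp.1
      · exact lt_asymm (symm_lower_lt_symm_upper σ c) hp.2
  · intro he
    have h1 : (c.colour, σ c.colour c.lower, σ c.colour c.upper) ∈ inversions (step σ c) :=
      mem_inversions.2 ⟨h, step_symm_upper_lt σ c⟩
    rw [← he, mem_inversions] at h1
    exact lt_asymm (symm_lower_lt_symm_upper σ c) h1.2

lemma perm_eq_one_of_lt_succ (τ : Equiv.Perm (Fin n))
    (h : ∀ i j : Fin n, (i : ℕ) + 1 = j → τ i ≤ τ j) : τ = 1 := by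
  have hm : Monotone τ := by
    cases n with
    | zero => exact fun i => i.elim0
    | succ n => exact Fin.monotone_iff_le_succ.2 fun i => h _ _ (by simp)
  have hs : StrictMono τ := hm.strictMono_of_injective τ.injective
  ext i
  have := StrictMono.range_inj (f := τ) (g := id) hs strictMono_id
  simpa using congrArg Fin.val (congrFun (this.1 (by simp)) i)

lemma startOrder_mul_self (a : Colour) : startOrder n a * startOrder n a = 1 := by
  ext i
  cases a <;> simp [startOrder]

/-- Every state is reached from the initial one by allowed intersections. -/
lemma state_induction {P : State n → Prop} (h0 : P (startOrder n))
    (hs : ∀ σ c, P σ → Allowed σ c → P (step σ c)) (σ : State n) : P σ := by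
  induction hk : (inversions σ).card using Nat.strong_induction_on generalizing σ with
  | _ k ih =>
    -- If two adjacent lines are out of their initial order, undoing their crossing leads to a state
    -- with fewer inversions. If there are none, the composite with `startOrder` is a monotone
    -- permutation, hence the identity.
    by_cases h : ∃ c : Crossing n, startOrder n c.colour (σ c.colour c.upper) <
        startOrder n c.colour (σ c.colour c.lower)
    · obtain ⟨c, hc⟩ := h
      have hal : Allowed (step σ c) c := by
        rw [Allowed, step_apply_self]
        simpa using hc
      have hlt := inversions_ssubset_step hal
      rw [step_step] at hlt
      have := hs _ c (ih _ (hk ▸ Finset.card_lt_card hlt) (step σ c) rfl) hal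
      rwa [step_step] at this
    · push Not at h
      have : σ = startOrder n := by
        funext a
        have h1 : startOrder n a * σ a = 1 := by
          refine perm_eq_one_of_lt_succ _ fun i j hij => ?_
          have hj := j.isLt
          have := h ⟨a, ⟨i, by omega⟩⟩
          have ej : j = ⟨i + 1, by omega⟩ := Fin.ext hij.symm
          rw [ej]
          exact this
        calc σ a = startOrder n a * startOrder n a * σ a := by rw [startOrder_mul_self, one_mul]
          _ = startOrder n a := by rw [mul_assoc, h1, mul_one]
      rwa [this]

end States

/-! ### Positive states -/

section PositiveStates

variable {𝕜 : Type*} [RCLike 𝕜] {n : ℕ} (x : Matrix (Fin n) (Fin n) 𝕜)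

/-- The matrix `x` or its transpose, such that the rows correspond to the colour `a`. -/
def matrixOf : Colour → Matrix (Fin n) (Fin n) 𝕜
  | .light => x
  | .dark => x.transpose

/-- All minors visible in the state `σ` are positive. -/
def PosState (σ : State n) : Prop :=
  ∀ k ≤ n, 0 < minor x (lowest σ .light k) (lowest σ .dark k)

variable {x}

lemma minor_matrixOf_other (a : Colour) {I J : Finset (Fin n)} (h : I.card = J.card) :
    minor (matrixOf x a.other) I J = minor (matrixOf x a) J I := by
  cases a
  · exact minor_transpose x h.symm
  · exact (minor_transpose x h).symm

lemma posState_iff (a : Colour) {σ : State n} :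
    PosState x σ ↔ ∀ k ≤ n, 0 < minor (matrixOf x a) (lowest σ a k) (lowest σ a.other k) := by
  cases a
  · rfl
  · refine forall₂_congr fun k hk => ?_
    have := minor_transpose x (I := lowest σ .light k) (J := lowest σ .dark k)
      (by rw [card_lowest _ _ hk, card_lowest _ _ hk])
    simp only [matrixOf, Colour.other, this]

variable (x) in
/-- The minor which becomes visible after the intersection `c`. -/
noncomputable def newMinor (σ : State n) (c : Crossing n) : 𝕜 :=
  minor (matrixOf x c.colour) (insert (σ c.colour c.upper) (lowest σ c.colour c.pos))
    (lowest σ c.colour.other c.height)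

/-- A crossing changes the visible minor only at its own height, so positivity of the next state
hinges on one minor. -/
lemma posState_step_iff {σ : State n} (c : Crossing n) (h : PosState x σ) :
    PosState x (step σ c) ↔ 0 < newMinor x σ c := by
  have hh := c.height_le
  have e : newMinor x σ c = minor (matrixOf x c.colour) (lowest (step σ c) c.colour c.height)
      (lowest (step σ c) c.colour.other c.height) := by
    rw [lowest_step_height, lowest_step_of_colour_ne _ _ _ (Colour.other_ne _), newMinor]
  rw [e, posState_iff c.colour]
  refine ⟨fun h => h _ (by omega), fun h' k hk => ?_⟩
  by_cases hkc : k = c.height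
  · rwa [hkc]
  · rw [lowest_step_of_ne _ _ _ hkc, lowest_step_of_ne _ _ _ hkc]
    exact (posState_iff c.colour).1 h k hk

end PositiveStates

/-! ### Positivity around the squares and hexagons of crossings -/

section Exchange

variable {𝕜 : Type*} [RCLike 𝕜] {n : ℕ} {x : Matrix (Fin n) (Fin n) 𝕜}

/-- The two intersections do not have a line in common. -/
def Crossing.Indep (c d : Crossing n) : Prop :=
  c.colour = d.colour → (c.pos : ℕ) + 1 < d.pos ∨ (d.pos : ℕ) + 1 < c.pos

lemma Crossing.Indep.symm {c d : Crossing n} (h : c.Indep d) : d.Indep c :=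
  fun e => (h e.symm).symm

lemma Crossing.Indep.step_lower {c d : Crossing n} (h : c.Indep d) (σ : State n) :
    step σ c d.colour d.lower = σ d.colour d.lower := by
  by_cases e : c.colour = d.colour
  · rw [← e, step_apply_self, Equiv.Perm.mul_apply, Equiv.swap_apply_of_ne_of_ne]
    all_goals
      have := h e
      simp only [Crossing.lower, Crossing.upper, ne_eq, Fin.ext_iff]
      omega
  · rw [step_apply_of_ne _ _ (Ne.symm e)]

lemma Crossing.Indep.step_upper {c d : Crossing n} (h : c.Indep d) (σ : State n) :
    step σ c d.colour d.upper = σ d.colour d.upper := by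
  by_cases e : c.colour = d.colour
  · rw [← e, step_apply_self, Equiv.Perm.mul_apply, Equiv.swap_apply_of_ne_of_ne]
    all_goals
      have := h e
      simp only [Crossing.lower, Crossing.upper, ne_eq, Fin.ext_iff]
      omega
  · rw [step_apply_of_ne _ _ (Ne.symm e)]

lemma Crossing.Indep.allowed_step_iff {c d : Crossing n} (h : c.Indep d) (σ : State n) :
    Allowed (step σ c) d ↔ Allowed σ d := by
  rw [Allowed, Allowed, h.step_lower, h.step_upper]

lemma Crossing.Indep.step_comm {c d : Crossing n} (h : c.Indep d) (σ : State n) :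
    step (step σ c) d = step (step σ d) c := by
  funext a
  by_cases hc : a = c.colour <;> by_cases hd : a = d.colour
  · subst hc
    have e : Equiv.swap c.lower c.upper * Equiv.swap d.lower d.upper =
        Equiv.swap d.lower d.upper * Equiv.swap c.lower c.upper := by
      refine Equiv.Perm.Disjoint.commute ?_
      intro i
      have := h hd
      by_cases hi : i = c.lower ∨ i = c.upper
      · right
        apply Equiv.swap_apply_of_ne_of_ne
        all_goals
          simp only [Crossing.lower, Crossing.upper, ne_eq, Fin.ext_iff] at hi ⊢
          omega
      · left
        push Not at hi
        exact Equiv.swap_apply_of_ne_of_ne hi.1 hi.2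
    rw [step_apply_self, hd, step_apply_self, ← hd, step_apply_self, hd, step_apply_self,
      mul_assoc, mul_assoc, e]
  · subst hc
    rw [step_apply_of_ne _ _ hd, step_apply_self, step_apply_self, step_apply_of_ne _ _ hd]
  · subst hd
    rw [step_apply_of_ne _ _ hc, step_apply_self, step_apply_self, step_apply_of_ne _ _ hc]
  · simp only [step_apply_of_ne _ _ hd, step_apply_of_ne _ _ hc]

/-- The crossing c alters only one lowest set, that of its own colour at its own height, and the new
minor of d does not read it. Opposite colours at equal height are the exception, settled by
`newMinor_pos_of_pos_eq`. -/
lemma Crossing.Indep.newMinor_step {c d : Crossing n} (h : c.Indep d) (hp : c.pos ≠ d.pos)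
    (σ : State n) : newMinor x (step σ c) d = newMinor x σ d := by
  rw [Fin.ext_iff.ne] at hp
  rw [newMinor, newMinor, h.step_upper]
  by_cases e : c.colour = d.colour
  · have := h e
    rw [lowest_step_of_colour_ne (a := d.colour.other) _ _ _ (e.symm ▸ Colour.other_ne d.colour),
      lowest_step_of_ne _ _ _ (by simp only [Crossing.height]; omega)]
  · rw [lowest_step_of_colour_ne _ _ (d.pos : ℕ) (Ne.symm e),
      lowest_step_of_ne _ _ _ (by simp only [Crossing.height]; omega)]

/-- The four minors at this height come from one added row and one added column, each with two
choices. In the exchange relation the new minors of c and d taken from σ form the product that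
equals a sum of positive terms. -/
lemma newMinor_pos_of_pos_eq {σ : State n} {c d : Crossing n} (hcol : d.colour = c.colour.other)
    (hpos : c.pos = d.pos) (hc : Allowed σ c) (hd : Allowed σ d) (hσ : PosState x σ)
    (h1 : 0 < newMinor x σ c) (h2 : 0 < newMinor x (step σ c) d) : 0 < newMinor x σ d := by
  obtain ⟨a, p⟩ := c
  obtain ⟨b, q⟩ := d
  dsimp only at hcol hpos
  subst hcol hpos
  set c : Crossing n := ⟨a, p⟩ with hcdef
  have hp := p.isLt
  have hup : (c.upper : ℕ) = p + 1 := rfl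
  have hlow : (c.lower : ℕ) = p := rfl
  have hA : ∀ e, σ e c.lower ∉ lowest σ e p := fun e => by rw [mem_lowest]; omega
  have hA' : ∀ e, σ e c.upper ∉ lowest σ e p := fun e => by rw [mem_lowest]; omega
  have hcd : ∀ e k, k ≤ n → (lowest σ e k).card = k := fun e k => card_lowest σ e
  have hheight : ∀ e, lowest σ e (p + 1) = insert (σ e c.lower) (lowest σ e p) :=
    fun e => lowest_succ σ e c.lower
  have hheight2 : ∀ e, lowest σ e (p + 1 + 1) =
      insert (σ e c.upper) (insert (σ e c.lower) (lowest σ e p)) :=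
    fun e => by rw [← hheight]; exact lowest_succ σ e c.upper
  have hcard : ∀ e, (insert (σ e c.lower) (lowest σ e p)).card = p + 1 := fun e => by
    rw [Finset.card_insert_of_notMem (hA e), hcd e _ (by omega)]
  have hcard' : ∀ e, (insert (σ e c.upper) (lowest σ e p)).card = p + 1 := fun e => by
    rw [Finset.card_insert_of_notMem (hA' e), hcd e _ (by omega)]
  have k0 := (posState_iff a).1 hσ p (by omega)
  have k2 := (posState_iff a).1 hσ (p + 1 + 1) (by omega)
  rw [hheight2, hheight2] at k2
  have m1 : newMinor x σ c = minor (matrixOf x a) (insert (σ a c.upper) (lowest σ a p))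
      (insert (σ a.other c.lower) (lowest σ a.other p)) := by
    rw [← hheight]; rfl
  have m2 : newMinor x (step σ c) ⟨a.other, p⟩ =
      minor (matrixOf x a) (insert (σ a c.upper) (lowest σ a p))
      (insert (σ a.other c.upper) (lowest σ a.other p)) := by
    rw [← minor_matrixOf_other _ (by rw [hcard', hcard'])]
    have e1 := lowest_step_height σ c
    have e2 := step_apply_of_ne σ c (a := a.other) (Colour.other_ne _)
    have e3 := lowest_step_of_colour_ne σ c p (a := a.other) (Colour.other_ne _)
    change lowest (step σ c) a (p + 1) = insert (σ a c.upper) (lowest σ a p) at e1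
    change minor (matrixOf x a.other) (insert (step σ c a.other c.upper)
      (lowest (step σ c) a.other p)) (lowest (step σ c) a.other.other (p + 1)) = _
    rw [Colour.other_other, e1, e2, e3]
  have m3 : newMinor x σ ⟨a.other, p⟩ =
      minor (matrixOf x a) (insert (σ a c.lower) (lowest σ a p))
      (insert (σ a.other c.upper) (lowest σ a.other p)) := by
    rw [← minor_matrixOf_other _ (by rw [hcard', hcard])]
    change minor (matrixOf x a.other) (insert (σ a.other c.upper)
      (lowest σ a.other p)) (lowest σ a.other.other (p + 1)) = _
    rw [Colour.other_other, hheight]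
  rw [m1] at h1
  rw [m2] at h2
  rw [m3]
  have k1 := (posState_iff a).1 hσ (p + 1) (by omega)
  rw [hheight, hheight] at k1
  have hAB : (lowest σ a p).card = (lowest σ a.other p).card := by
    rw [hcd _ _ (by omega), hcd _ _ (by omega)]
  -- The opposite numbering of the light lines matters here: an allowed light crossing lowers the
  -- row index, so the old minor and the one after both crossings stand on the additive side of the
  -- relation.
  cases a
  · have h3 : σ .light c.upper < σ .light c.lower := Fin.rev_lt_rev.1 hc
    have h4 : σ .dark c.lower < σ .dark c.upper := hd
    rw [Finset.insert_comm (σ (Colour.other .light) c.upper)] at k2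
    exact pos_of_mul_pos_of_pos h1 (minor_pos_exchange (matrixOf x .light) hAB (hA' _) (hA _) h3
      (hA _) (hA' _) h4 k0 k2 h2 k1)
  · have h3 : σ .dark c.lower < σ .dark c.upper := hc
    have h4 : σ .light c.upper < σ .light c.lower := Fin.rev_lt_rev.1 hd
    rw [Finset.insert_comm (σ .dark c.upper)] at k2
    refine pos_of_mul_pos_of_pos h1 ?_
    rw [mul_comm]
    exact (minor_pos_exchange (matrixOf x .dark) hAB (hA _) (hA' _) h3
      (hA' _) (hA _) h4 k0 k2 k1 h2)

/-- Writes the new minors at two neighbouring heights over the common base `lowest σ a p`, so that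
those occurring around a hexagon can be compared. -/
lemma newMinor_eq_of_agree {σ τ : State n} {a : Colour} {p q : Fin (n - 1)}
    (hpq : (p : ℕ) + 1 = q) (hA : lowest τ a p = lowest σ a p) (hB : τ a.other = σ a.other) :
    newMinor x τ ⟨a, p⟩ = minor (matrixOf x a)
      (insert (τ a (Crossing.mk a p).upper) (lowest σ a p)) (lowest σ a.other (p + 1)) ∧
    newMinor x τ ⟨a, q⟩ = minor (matrixOf x a)
      (insert (τ a (Crossing.mk a q).upper) (insert (τ a (Crossing.mk a p).lower) (lowest σ a p)))
      (lowest σ a.other (p + 1 + 1)) := by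
  have hB' : ∀ k, lowest τ a.other k = lowest σ a.other k := fun k => by
    rw [lowest, lowest, hB]
  have h1 : lowest τ a (p + 1) = insert (τ a (Crossing.mk a p).lower) (lowest σ a p) := by
    rw [← hA]; exact lowest_succ τ a (Crossing.mk a p).lower
  constructor
  · rw [← hA, ← hB']; rfl
  · rw [← h1, ← hB', hpq]; rfl

/-- The two ways to resolve a triple intersection are exchanged by a three-term relation. -/
lemma newMinor_pos_braid {σ : State n} {a : Colour} {p q : Fin (n - 1)}
    (hpq : (p : ℕ) + 1 = q) (hp : Allowed σ ⟨a, p⟩) (hq : Allowed σ ⟨a, q⟩) (hσ : PosState x σ)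
    (h : 0 < newMinor x (step (step σ ⟨a, p⟩) ⟨a, q⟩) ⟨a, p⟩ ∨
      0 < newMinor x (step σ ⟨a, q⟩) ⟨a, p⟩)
    (h' : 0 < newMinor x (step σ ⟨a, p⟩) ⟨a, q⟩ ∨
      0 < newMinor x (step (step σ ⟨a, q⟩) ⟨a, p⟩) ⟨a, q⟩) :
    0 < newMinor x σ ⟨a, p⟩ * newMinor x σ ⟨a, q⟩ ∧
    newMinor x (step (step σ ⟨a, p⟩) ⟨a, q⟩) ⟨a, p⟩ = newMinor x (step σ ⟨a, q⟩) ⟨a, p⟩ ∧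
    newMinor x (step σ ⟨a, p⟩) ⟨a, q⟩ = newMinor x (step (step σ ⟨a, q⟩) ⟨a, p⟩) ⟨a, q⟩ := by
  set c : Crossing n := ⟨a, p⟩ with hc
  set d : Crossing n := ⟨a, q⟩ with hd
  have hqn := q.isLt
  have hdl : d.lower = c.upper := Fin.ext hpq.symm
  have n01 : c.lower ≠ c.upper := c.lower_ne_upper
  have n12 : c.upper ≠ d.upper := hdl ▸ d.lower_ne_upper
  have n02 : c.lower ≠ d.upper := by
    simp only [hc, hd, Crossing.lower, Crossing.upper, ne_eq, Fin.ext_iff]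
    omega
  have hcA : ∀ τ : State n, lowest (step τ c) a p = lowest τ a p := fun τ =>
    lowest_step_of_ne τ c a (by simp [hc, Crossing.height])
  have hdA : ∀ τ : State n, lowest (step τ d) a p = lowest τ a p := fun τ =>
    lowest_step_of_ne τ d a (by simp only [hd, Crossing.height]; omega)
  have hcB : ∀ τ : State n, step τ c a.other = τ a.other := fun τ =>
    step_apply_of_ne τ c (Colour.other_ne a)
  have hdB : ∀ τ : State n, step τ d a.other = τ a.other := fun τ =>
    step_apply_of_ne τ d (Colour.other_ne a)
  have sc : ∀ (τ : State n) (i : Fin n), step τ c a i = τ a (Equiv.swap c.lower c.upper i) :=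
    fun τ i => by rw [show step τ c a = _ from step_apply_self τ c]; rfl
  have sd : ∀ (τ : State n) (i : Fin n), step τ d a i = τ a (Equiv.swap c.upper d.upper i) :=
    fun τ i => by rw [show step τ d a = _ from step_apply_self τ d, hdl]; rfl
  have c1 : Equiv.swap c.lower c.upper d.upper = d.upper :=
    Equiv.swap_apply_of_ne_of_ne n02.symm n12.symm
  have e1 := (newMinor_eq_of_agree (x := x) hpq (rfl : lowest σ a p = _) rfl).1
  have e2 := (newMinor_eq_of_agree (x := x) hpq (rfl : lowest σ a p = _) rfl).2
  have e3 := (newMinor_eq_of_agree (x := x) hpq (hcA σ) (hcB σ)).2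
  have e4 := (newMinor_eq_of_agree (x := x) hpq ((hdA _).trans (hcA σ)) ((hdB _).trans (hcB σ))).1
  have e5 := (newMinor_eq_of_agree (x := x) hpq (hdA σ) (hdB σ)).1
  have e6 := (newMinor_eq_of_agree (x := x) hpq ((hcA _).trans (hdA σ)) ((hcB _).trans (hdB σ))).2
  simp only [← hc, ← hd, sc, sd, Equiv.swap_apply_left, Equiv.swap_apply_right, c1]
    at e1 e2 e3 e4 e5 e6
  rw [Finset.insert_comm] at e6
  rw [e4, e5, or_self] at h
  rw [e3, e6, or_self] at h'
  rw [e3, e4, e5, e6]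
  refine ⟨?_, rfl, rfl⟩
  rw [e1, e2]
  have hB1 : lowest σ a.other (p + 1) = insert (σ a.other c.lower) (lowest σ a.other p) :=
    lowest_succ σ a.other c.lower
  have hB2 : lowest σ a.other (p + 1 + 1) =
      insert (σ a.other c.upper) (insert (σ a.other c.lower) (lowest σ a.other p)) := by
    rw [← hB1]; exact lowest_succ σ a.other c.upper
  have hA1 : lowest σ a (p + 1) = insert (σ a c.lower) (lowest σ a p) :=
    lowest_succ σ a c.lower
  have hA2 : lowest σ a (p + 1 + 1) =
      insert (σ a c.upper) (insert (σ a c.lower) (lowest σ a p)) := by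
    rw [← hA1]; exact lowest_succ σ a c.upper
  have k0 := (posState_iff a).1 hσ p (by omega)
  have k1 := (posState_iff a).1 hσ (p + 1) (by omega)
  have k2 := (posState_iff a).1 hσ (p + 1 + 1) (by omega)
  rw [hA1] at k1
  rw [hA2] at k2
  rw [hB1] at h k1 ⊢
  rw [hB2] at h' k2 ⊢
  have hcl : (c.lower : ℕ) = p := rfl
  have hcu : (c.upper : ℕ) = p + 1 := rfl
  have hdu : (d.upper : ℕ) = q + 1 := rfl
  refine minor_pos_rows (matrixOf x a) (by rw [card_lowest, card_lowest] <;> omega)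
    (by rw [mem_lowest]; omega) (by rw [mem_lowest]; omega) (by rw [mem_lowest]; omega) ?_
    (by rw [mem_lowest]; omega) (by rw [mem_lowest]; omega) ?_ k0 k1 h k2 h'
  · have hq' : startOrder n a (σ a c.upper) < startOrder n a (σ a d.upper) := by
      rw [← hdl]; exact hq
    -- The three line numbers are monotone from bottom to top: decreasing for light, increasing for
    -- dark. The three-row relation is symmetric under this reversal.
    cases a
    · exact Or.inr ⟨Fin.rev_lt_rev.1 hq', Fin.rev_lt_rev.1 hp⟩
    · exact Or.inl ⟨hp, hq'⟩
  · exact fun h => n01 ((σ a.other).injective h)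

lemma step_braid (σ : State n) (a : Colour) {p q : Fin (n - 1)} (hpq : (p : ℕ) + 1 = q) :
    step (step (step σ ⟨a, p⟩) ⟨a, q⟩) ⟨a, p⟩ = step (step (step σ ⟨a, q⟩) ⟨a, p⟩) ⟨a, q⟩ := by
  funext b
  by_cases hb : b = a
  · subst hb
    have sc : ∀ (τ : State n) (r : Fin (n - 1)), step τ ⟨b, r⟩ b =
        τ b * Equiv.swap (Crossing.mk b r).lower (Crossing.mk b r).upper :=
      fun τ r => step_apply_self τ ⟨b, r⟩
    have hdl : (Crossing.mk b q).lower = (Crossing.mk b p).upper := Fin.ext hpq.symm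
    have n01 := (Crossing.mk b p).lower_ne_upper
    have n12 := (Crossing.mk b q).lower_ne_upper
    have n02 : (Crossing.mk b p).lower ≠ (Crossing.mk b q).upper := by
      simp only [Crossing.lower, Crossing.upper, ne_eq, Fin.ext_iff]
      omega
    rw [hdl] at n12
    simp only [sc, mul_assoc, hdl]
    congr 1
    have r1 := Equiv.swap_mul_swap_mul_swap n12.symm n02.symm
    rw [Equiv.swap_comm (Crossing.mk b p).upper (Crossing.mk b p).lower,
      Equiv.swap_comm (Crossing.mk b q).upper] at r1
    rw [← mul_assoc, ← mul_assoc, r1, Equiv.swap_mul_swap_mul_swap n01 n02, Equiv.swap_comm]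
  · have : ∀ (τ : State n) (r : Fin (n - 1)), step τ ⟨a, r⟩ b = τ b :=
      fun τ r => step_apply_of_ne τ _ hb
    simp only [this]

end Exchange

/-! ### Independence of the path and total positivity -/

section Confluence

variable {𝕜 : Type*} [RCLike 𝕜] {n : ℕ} {x : Matrix (Fin n) (Fin n) 𝕜}

variable (x) in
/-- From the state there is a sequence of `l` allowed intersections to a final state, with only
positive states on the way. -/
inductive HasPosPath : ℕ → State n → Prop
  | final {σ : State n} : PosState x σ → (∀ c, ¬ Allowed σ c) → HasPosPath 0 σ
  | move {l : ℕ} {σ : State n} {c : Crossing n} :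
      PosState x σ → Allowed σ c → HasPosPath l (step σ c) → HasPosPath (l + 1) σ

lemma HasPosPath.posState {l : ℕ} {σ : State n} (h : HasPosPath x l σ) : PosState x σ := by
  cases h <;> assumption

lemma HasPosPath.exists_eq_succ {l : ℕ} {σ : State n} (h : HasPosPath x l σ) {c : Crossing n}
    (hc : Allowed σ c) : ∃ m, l = m + 1 := by
  cases h with
  | final _ h => exact absurd hc (h c)
  | move => exact ⟨_, rfl⟩

lemma Crossing.trichotomy (c d : Crossing n) : c = d ∨ c.Indep d ∨
    ∃ (a : Colour) (p q : Fin (n - 1)), (p : ℕ) + 1 = q ∧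
      ((c = ⟨a, p⟩ ∧ d = ⟨a, q⟩) ∨ (c = ⟨a, q⟩ ∧ d = ⟨a, p⟩)) := by
  obtain ⟨a, p⟩ := c
  obtain ⟨b, q⟩ := d
  by_cases hab : a = b
  · subst hab
    by_cases h1 : (p : ℕ) = q
    · exact Or.inl (by rw [Fin.ext h1])
    · by_cases h2 : (p : ℕ) + 1 = q
      · exact Or.inr (Or.inr ⟨a, p, q, h2, Or.inl ⟨rfl, rfl⟩⟩)
      · by_cases h3 : (q : ℕ) + 1 = p
        · exact Or.inr (Or.inr ⟨a, q, p, h3, Or.inr ⟨rfl, rfl⟩⟩)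
        · exact Or.inr (Or.inl fun _ => by dsimp only; omega)
  · exact Or.inr (Or.inl fun h => absurd h hab)

/-- The intersections of three lines, resolved pairwise, stay allowed. -/
lemma allowed_braid {σ : State n} {a : Colour} {p q : Fin (n - 1)}
    (hpq : (p : ℕ) + 1 = q) (hp : Allowed σ ⟨a, p⟩) (hq : Allowed σ ⟨a, q⟩) :
    (Allowed (step σ ⟨a, p⟩) ⟨a, q⟩ ∧ Allowed (step (step σ ⟨a, p⟩) ⟨a, q⟩) ⟨a, p⟩) ∧
    (Allowed (step σ ⟨a, q⟩) ⟨a, p⟩ ∧ Allowed (step (step σ ⟨a, q⟩) ⟨a, p⟩) ⟨a, q⟩) := by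
  set c : Crossing n := ⟨a, p⟩ with hc
  set d : Crossing n := ⟨a, q⟩ with hd
  have hdl : d.lower = c.upper := Fin.ext hpq.symm
  have n01 : c.lower ≠ c.upper := c.lower_ne_upper
  have n12 : c.upper ≠ d.upper := hdl ▸ d.lower_ne_upper
  have n02 : c.lower ≠ d.upper := by
    simp only [hc, hd, Crossing.lower, Crossing.upper, ne_eq, Fin.ext_iff]
    omega
  have sc : ∀ (τ : State n) (i : Fin n), step τ c a i = τ a (Equiv.swap c.lower c.upper i) :=
    fun τ i => by rw [show step τ c a = _ from step_apply_self τ c]; rfl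
  have sd : ∀ (τ : State n) (i : Fin n), step τ d a i = τ a (Equiv.swap c.upper d.upper i) :=
    fun τ i => by rw [show step τ d a = _ from step_apply_self τ d, hdl]; rfl
  have c1 : Equiv.swap c.lower c.upper d.upper = d.upper :=
    Equiv.swap_apply_of_ne_of_ne n02.symm n12.symm
  have d1 : Equiv.swap c.upper d.upper c.lower = c.lower :=
    Equiv.swap_apply_of_ne_of_ne n01 n02
  have ac : ∀ τ : State n, Allowed τ c ↔
      startOrder n a (τ a c.lower) < startOrder n a (τ a c.upper) := fun τ => Iff.rfl
  have ad : ∀ τ : State n, Allowed τ d ↔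
      startOrder n a (τ a c.upper) < startOrder n a (τ a d.upper) := fun τ => by
    rw [← hdl]; exact Iff.rfl
  rw [ac] at hp
  rw [ad] at hq
  simp only [ac, ad, sc, sd, Equiv.swap_apply_left, Equiv.swap_apply_right, c1, d1]
  exact ⟨⟨hp.trans hq, hq⟩, hp.trans hq, hp⟩

/-- A diamond-lemma argument: the first crossing a of the given path and the crossing b are
completed to a common state. The induction hypothesis, applied along the given side, yields a
positive path from that state, and the three-term relations make the states on the other side
positive. -/
lemma HasPosPath.step {l : ℕ} {σ : State n} (h : HasPosPath x (l + 1) σ) {b : Crossing n}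
    (hb : Allowed σ b) : HasPosPath x l (step σ b) := by
  induction l using Nat.strong_induction_on generalizing σ b with
  | _ l ih =>
    cases h with
    | move hσ ha hg =>
      rename_i a
      rcases Crossing.trichotomy a b with rfl | hi | ⟨e, p, q, hpq, hcases⟩
      · exact hg
      · have hb' := (hi.allowed_step_iff σ).2 hb
        obtain ⟨m, rfl⟩ := hg.exists_eq_succ hb'
        have h2 := ih m (by omega) hg hb'
        have hpb : PosState x (TotalPositivity.step σ b) := by
          rw [posState_step_iff b hσ]
          have k1 := (posState_step_iff a hσ).1 hg.posState
          have k2 := (posState_step_iff b hg.posState).1 h2.posState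
          -- At equal positions independence forces opposite colours, which is the case of the
          -- exchange relation. Otherwise the new minor of b is unaffected by a.
          by_cases hp : a.pos = b.pos
          · refine newMinor_pos_of_pos_eq (Colour.eq_other_of_ne fun hcol => ?_) hp ha hb hσ k1 k2
            have := hi hcol.symm
            rw [hp] at this
            omega
          · rwa [hi.newMinor_step hp] at k2
        rw [hi.step_comm] at h2
        exact HasPosPath.move hpb ((hi.symm.allowed_step_iff σ).2 ha) h2
      -- The hexagon is treated once for both orientations: the states along a, b, a are positive by
      -- induction, and only those after b and after b, a remain to be checked.
      · have finish : Allowed (TotalPositivity.step σ a) b →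
            Allowed (TotalPositivity.step (TotalPositivity.step σ a) b) a →
            Allowed (TotalPositivity.step σ b) a →
            Allowed (TotalPositivity.step (TotalPositivity.step σ b) a) b →
            TotalPositivity.step (TotalPositivity.step (TotalPositivity.step σ a) b) a =
              TotalPositivity.step (TotalPositivity.step (TotalPositivity.step σ b) a) b →
            (0 < newMinor x (TotalPositivity.step σ a) b →
              0 < newMinor x (TotalPositivity.step (TotalPositivity.step σ a) b) a →
              0 < newMinor x σ a * newMinor x σ b ∧
              0 < newMinor x (TotalPositivity.step σ b) a) →
            HasPosPath x l (TotalPositivity.step σ b) := by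
          intro a1 a2 b1 b2 hbraid hpos
          obtain ⟨m, rfl⟩ := hg.exists_eq_succ a1
          have h2 := ih m (by omega) hg a1
          obtain ⟨r, rfl⟩ := h2.exists_eq_succ a2
          have h3 := ih r (by omega) h2 a2
          have k1 := (posState_step_iff a hσ).1 hg.posState
          have k2 := (posState_step_iff b hg.posState).1 h2.posState
          have k3 := (posState_step_iff a h2.posState).1 h3.posState
          have hb1 := (posState_step_iff b hσ).2 (pos_of_mul_pos_of_pos k1 (hpos k2 k3).1)
          rw [hbraid] at h3
          exact HasPosPath.move hb1 b1
            (HasPosPath.move ((posState_step_iff a hb1).2 (hpos k2 k3).2) b2 h3)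
        rcases hcases with ⟨rfl, rfl⟩ | ⟨rfl, rfl⟩
        · have al := allowed_braid hpq ha hb
          refine finish al.1.1 al.1.2 al.2.1 al.2.2 (step_braid σ e hpq) fun k2 k3 => ?_
          obtain ⟨h1, h2, -⟩ := newMinor_pos_braid hpq ha hb hσ (Or.inl k3) (Or.inl k2)
          exact ⟨h1, h2 ▸ k3⟩
        · have al := allowed_braid hpq hb ha
          refine finish al.2.1 al.2.2 al.1.1 al.1.2 (step_braid σ e hpq).symm fun k2 k3 => ?_
          obtain ⟨h1, -, h2⟩ := newMinor_pos_braid hpq hb ha hσ (Or.inr k2) (Or.inr k3)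
          exact ⟨by rwa [mul_comm], h2 ▸ k3⟩

/-- If one path from the initial state has only positive states, all states are positive. -/
lemma HasPosPath.posState_of_start {l : ℕ} (h : HasPosPath x l (startOrder n)) (σ : State n) :
    PosState x σ := by
  have : ∃ m, HasPosPath x m σ := by
    refine state_induction (P := fun τ => ∃ m, HasPosPath x m τ) ⟨l, h⟩ (fun τ c hτ hc => ?_) σ
    obtain ⟨m, hm⟩ := hτ
    obtain ⟨r, rfl⟩ := hm.exists_eq_succ hc
    exact ⟨r, hm.step hc⟩
  obtain ⟨m, hm⟩ := this
  exact hm.posState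

lemma exists_perm_image_eq (I : Finset (Fin n)) : ∃ τ : Equiv.Perm (Fin n),
    (Finset.univ.filter fun i : Fin n => (i : ℕ) < I.card).image τ = I := by
  have hk : I.card ≤ n := by simpa using Finset.card_le_univ I
  let s : Finset (Fin n) := Finset.univ.filter fun i : Fin n => (i : ℕ) < I.card
  have hs : s.card = I.card := by
    rw [Fin.card_filter_val_lt, min_eq_right hk]
  have e : {i // i ∈ s} ≃ {i // i ∈ I} := Finset.equivOfCardEq hs
  refine ⟨e.extendSubtype, ?_⟩
  refine Finset.eq_of_subset_of_card_le ?_ ?_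
  · intro j hj
    obtain ⟨i, hi, rfl⟩ := Finset.mem_image.1 hj
    exact e.extendSubtype_mem i hi
  · rw [Finset.card_image_of_injective _ (Equiv.injective _)]
    exact hs.ge

/-- The two colours can be permuted independently, so any I and J of equal size occur together as
lowest sets of one state. -/
lemma isTotallyPositive_of_posState (h : ∀ σ : State n, PosState x σ) : IsTotallyPositive x := by
  intro I J hIJ
  obtain ⟨τ, hτ⟩ := exists_perm_image_eq I
  obtain ⟨ρ, hρ⟩ := exists_perm_image_eq J
  let σ : State n := fun a => match a with
    | .light => τ
    | .dark => ρ
  have := h σ I.card (by simpa using Finset.card_le_univ I)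
  have h1 : lowest σ .light I.card = I := hτ
  have h2 : lowest σ .dark I.card = J := by rw [hIJ.2]; exact hρ
  rwa [h1, h2] at this

end Confluence

/-! ### The states of a word -/

section Words

variable {n : ℕ}

/-- The state after the first `t` intersections. -/
def stateAt (w : List (Crossing n)) (t : ℕ) : State n := fun a => lineAt w a t

lemma stateAt_zero (w : List (Crossing n)) : stateAt w 0 = startOrder n := by
  funext a
  simp [stateAt, lineAt]

lemma stateAt_succ (w : List (Crossing n)) {t : ℕ} (ht : t < w.length) :
    stateAt w (t + 1) = step (stateAt w t) w[t] := by
  funext a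
  simp only [stateAt, lineAt, List.take_succ_eq_append_getElem ht, List.foldl_append,
    List.foldl_cons, List.foldl_nil]
  split_ifs with h
  · subst h
    rw [step_apply_self]
    rfl
  · rw [step_apply_of_ne _ _ (Ne.symm h)]
    rfl

lemma crossedPair_eq (w : List (Crossing n)) (t : Fin w.length) {a : Colour}
    (h : w[t].colour = a) :
    crossedPair w t = s(stateAt w t a w[t].lower, stateAt w t a w[t].upper) := by
  subst h
  rfl

/-- The relative order of two lines only changes when they meet. -/
lemma stateAt_order_iff (w : List (Crossing n)) {a : Colour} {p q : Fin n} (hpq : p ≠ q)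
    {s t : ℕ} (hst : s ≤ t) (ht : t ≤ w.length)
    (h : ∀ r : Fin w.length, s ≤ r → r < t → ¬ (w[r].colour = a ∧ crossedPair w r = s(p, q))) :
    (stateAt w t a).symm p < (stateAt w t a).symm q ↔
      (stateAt w s a).symm p < (stateAt w s a).symm q := by
  induction t, hst using Nat.le_induction with
  | base => rfl
  | succ t hst ih =>
    rw [← ih (by omega) fun r h1 h2 => h r h1 (by omega), stateAt_succ w (by omega)]
    refine symm_lt_step_iff _ _ hpq fun hc => h ⟨t, by omega⟩ hst (by simp) ⟨hc.1, ?_⟩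
    rw [crossedPair_eq w _ hc.1]
    exact hc.2

lemma stateAt_zero_order_iff (w : List (Crossing n)) {a : Colour} {p q : Fin n} :
    (stateAt w 0 a).symm p < (stateAt w 0 a).symm q ↔ startOrder n a p < startOrder n a q := by
  rw [stateAt_zero, startOrder_symm]

/-- After an allowed intersection the two lines have left their initial order. -/
lemma stateAt_succ_order {w : List (Crossing n)} {t : Fin w.length}
    (hal : Allowed (stateAt w t) w[t]) {a : Colour} {p q : Fin n} (ha : w[t].colour = a)
    (hp : crossedPair w t = s(p, q)) (hpq : startOrder n a p < startOrder n a q) :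
    (stateAt w (t + 1) a).symm q < (stateAt w (t + 1) a).symm p ∧
      (stateAt w t a).symm p < (stateAt w t a).symm q := by
  subst ha
  rw [crossedPair_eq w t rfl] at hp
  rcases Sym2.eq_iff.1 hp with ⟨rfl, rfl⟩ | ⟨rfl, rfl⟩
  · rw [stateAt_succ w t.isLt]
    exact ⟨step_symm_upper_lt _ _, symm_lower_lt_symm_upper _ _⟩
  · exact absurd hal (lt_asymm hpq)

lemma lowest_stateAt_succ (w : List (Crossing n)) {t : ℕ} (ht : t < w.length) (a : Colour) {k : ℕ}
    (hk : k ≠ w[t].height) : lowest (stateAt w (t + 1)) a k = lowest (stateAt w t) a k := by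
  rw [stateAt_succ w ht, lowest_step_of_ne _ _ _ hk]

/-- The sum of the initial levels of the lines at the lowest `k` levels. -/
def weight (σ : State n) (k : ℕ) : ℕ :=
  ∑ i ∈ lowest σ .light k, (startOrder n .light i : ℕ) +
    ∑ i ∈ lowest σ .dark k, (startOrder n .dark i : ℕ)

lemma weight_step_height {σ : State n} {c : Crossing n} (h : Allowed σ c) :
    weight σ c.height < weight (step σ c) c.height := by
  have key : ∑ i ∈ lowest σ c.colour c.height, (startOrder n c.colour i : ℕ) <
      ∑ i ∈ lowest (step σ c) c.colour c.height, (startOrder n c.colour i : ℕ) := by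
    rw [lowest_step_height, lowest_height, Finset.sum_insert, Finset.sum_insert]
    · exact Nat.add_lt_add_right h _
    · rw [mem_lowest]; simp [Crossing.upper]
    · rw [mem_lowest]; simp [Crossing.lower]
  obtain ⟨a, p⟩ := c
  cases a
  · have e := lowest_step_of_colour_ne σ ⟨.light, p⟩ (Crossing.mk .light p).height
      (a := .dark) (Colour.other_ne .light)
    rw [weight, weight, e]
    exact Nat.add_lt_add_right key _
  · have e := lowest_step_of_colour_ne σ ⟨.dark, p⟩ (Crossing.mk .dark p).height
      (a := .light) (Colour.other_ne .dark)
    rw [weight, weight, e]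
    exact Nat.add_lt_add_left key _

lemma weight_step_le {σ : State n} {c : Crossing n} (h : Allowed σ c) (k : ℕ) :
    weight σ k ≤ weight (step σ c) k := by
  by_cases hk : k = c.height
  · subst hk
    exact (weight_step_height h).le
  · rw [weight, weight, lowest_step_of_ne _ _ _ hk, lowest_step_of_ne _ _ _ hk]

end Words

/-! ### The chambers of a double wiring diagram -/

namespace DoubleWiringDiagram

variable {n : ℕ} (D : DoubleWiringDiagram n)

lemma label_eq (k t : ℕ) : D.label (k, t) =
    (lowest (stateAt D.crossings t) .light k, lowest (stateAt D.crossings t) .dark k) := rfl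

lemma stateAt_ne (w : List (Crossing n)) (t : ℕ) (a : Colour) (c : Crossing n) :
    stateAt w t a c.lower ≠ stateAt w t a c.upper :=
  fun h => c.lower_ne_upper ((stateAt w t a).injective h)

/-- The pair meeting at this crossing has not met before, so it is still in its initial order. -/
lemma allowed (t : Fin D.crossings.length) :
    Allowed (stateAt D.crossings t) D.crossings[t] := by
  have hne := stateAt_ne D.crossings t D.crossings[t].colour D.crossings[t]
  obtain ⟨t0, -, huniq⟩ := D.meet_once _ _ _ hne
  have ht : t = t0 := huniq t ⟨rfl, crossedPair_eq _ t rfl⟩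
  have := stateAt_order_iff D.crossings hne (Nat.zero_le t) t.isLt.le fun r _ hr hc => by
    have : r = t0 := huniq r hc
    rw [this, ← ht] at hr
    exact lt_irrefl _ hr
  rw [stateAt_zero_order_iff] at this
  exact this.1 (symm_lower_lt_symm_upper _ _)

/-- Every pair has met by the end and was reversed at that unique meeting; it never changes its
order again. -/
lemma not_allowed_end (c : Crossing n) :
    ¬ Allowed (stateAt D.crossings D.crossings.length) c := by
  intro hc
  have hne := stateAt_ne D.crossings D.crossings.length c.colour c
  obtain ⟨t0, ⟨h1, h2⟩, huniq⟩ := D.meet_once c.colour _ _ hne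
  have h3 := (stateAt_succ_order (D.allowed t0) h1 h2 hc).1
  have := stateAt_order_iff D.crossings (a := c.colour) hne.symm
    (Nat.succ_le_of_lt t0.isLt) le_rfl fun r hr _ hc => by
      rw [Sym2.eq_swap] at hc
      have : r = t0 := huniq r hc
      rw [this] at hr
      omega
  exact lt_asymm (this.2 h3) (symm_lower_lt_symm_upper _ _)

lemma mem_chambers {k t : ℕ} : (k, t) ∈ D.chambers ↔ (1 ≤ k ∧ k ≤ n) ∧
    (t = 0 ∨ ∃ s : Fin D.crossings.length, D.crossings[s].height = k ∧ t = s + 1) := by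
  simp only [chambers, Finset.mem_filter, Finset.mem_product, Finset.mem_Icc, Finset.mem_range,
    and_assoc]
  refine and_congr_right fun _ => and_congr_right fun _ => ?_
  constructor
  · rintro ⟨ht, h | h⟩
    · exact Or.inl h
    · obtain ⟨c, h1, h2⟩ := Option.map_eq_some_iff.1 h
      obtain ⟨h3, h4⟩ := List.getElem?_eq_some_iff.1 h1
      by_cases h0 : t = 0
      · exact Or.inl h0
      · refine Or.inr ⟨⟨t - 1, h3⟩, ?_, by simp only; omega⟩
        rw [← h2, ← h4]
        rfl
  · rintro (rfl | ⟨s, rfl, rfl⟩)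
    · simp
    · have := s.isLt
      refine ⟨by omega, Or.inr ?_⟩
      simp

/-- The sets below level k change only at crossings of height k, so the last such crossing, or else
the left end, opens a chamber with this label. -/
lemma exists_chamber {k t : ℕ} (hk : 1 ≤ k) (hkn : k ≤ n) (ht : t ≤ D.crossings.length) :
    ∃ c ∈ D.chambers, D.label c = D.label (k, t) := by
  induction t with
  | zero => exact ⟨(k, 0), D.mem_chambers.2 ⟨⟨hk, hkn⟩, Or.inl rfl⟩, rfl⟩
  | succ t ih =>
    by_cases h : k = D.crossings[t].height
    · exact ⟨(k, t + 1), D.mem_chambers.2 ⟨⟨hk, hkn⟩, Or.inr ⟨⟨t, ht⟩, h.symm, rfl⟩⟩, rfl⟩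
    · obtain ⟨c, hc, hl⟩ := ih (by omega)
      refine ⟨c, hc, ?_⟩
      rw [hl, label_eq, label_eq, lowest_stateAt_succ _ ht _ h, lowest_stateAt_succ _ ht _ h]

lemma weight_mono {s t : ℕ} (hst : s ≤ t) (ht : t ≤ D.crossings.length) (k : ℕ) :
    weight (stateAt D.crossings s) k ≤ weight (stateAt D.crossings t) k := by
  induction t, hst using Nat.le_induction with
  | base => rfl
  | succ t hst ih =>
    refine (ih (by omega)).trans ?_
    rw [stateAt_succ _ (by omega)]
    exact weight_step_le (D.allowed ⟨t, by omega⟩) k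

lemma weight_lt {s : ℕ} {t : Fin D.crossings.length} (hst : s ≤ t) :
    weight (stateAt D.crossings s) D.crossings[t].height <
      weight (stateAt D.crossings (t + 1)) D.crossings[t].height := by
  refine (D.weight_mono hst t.isLt.le _).trans_lt ?_
  rw [stateAt_succ _ t.isLt]
  exact weight_step_height (D.allowed t)

/-- The size of the label recovers the level k, and at a fixed level the weight strictly increases
from one chamber to the next. -/
lemma label_injOn : Set.InjOn D.label D.chambers := by
  have key : ∀ k s t, (k, s) ∈ D.chambers → (k, t) ∈ D.chambers → s < t →
      D.label (k, s) ≠ D.label (k, t) := by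
    intro k s t _ ht hst h
    rcases (D.mem_chambers.1 ht).2 with rfl | ⟨r, rfl, rfl⟩
    · omega
    · have := D.weight_lt (s := s) (t := r) (by omega)
      rw [label_eq, label_eq, Prod.mk.injEq] at h
      rw [weight, weight, h.1, h.2] at this
      exact lt_irrefl _ this
  rintro ⟨k, s⟩ hs ⟨l, t⟩ ht h
  rw [Finset.mem_coe] at hs ht
  have hkl : k = l := by
    have h1 := congrArg (fun p => p.1.card) h
    simp only [label_eq] at h1
    rwa [card_lowest _ _ (D.mem_chambers.1 hs).1.2, card_lowest _ _ (D.mem_chambers.1 ht).1.2]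
      at h1
  subst hkl
  rcases lt_trichotomy s t with hst | rfl | hst
  · exact absurd h (key k s t hs ht hst)
  · rfl
  · exact absurd h.symm (key k t s ht hs hst)

instance : Fintype Colour := ⟨{.light, .dark}, fun a => by cases a <;> decide⟩

/-- The condition `meet_once` is precisely a bijection between crossings and pairs of a colour and a
non-diagonal unordered pair of lines. -/
lemma length_crossings : D.crossings.length = 2 * n.choose 2 := by
  let φ : Fin D.crossings.length → Colour × {z : Sym2 (Fin n) // ¬ z.IsDiag} := fun t =>
    (D.crossings[t].colour, ⟨crossedPair D.crossings t, by
      rw [crossedPair_eq _ _ rfl, Sym2.mk_isDiag_iff]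
      exact stateAt_ne _ _ _ _⟩)
  have hφ : Function.Bijective φ := by
    rw [Function.bijective_iff_existsUnique]
    rintro ⟨a, z, hz⟩
    induction z using Sym2.ind with
    | _ p q =>
      have := D.meet_once a p q (by simpa using hz)
      refine (existsUnique_congr fun t => ?_).2 this
      simp only [φ, Prod.mk.injEq, Subtype.mk.injEq]
  have h := Fintype.card_of_bijective hφ
  rw [Fintype.card_fin, Fintype.card_prod, Sym2.card_subtype_not_diag, Fintype.card_fin] at h
  exact h

/-- A chamber is either open to the left, one for each level, or begins at exactly one crossing: n +
n(n-1) in all. -/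
lemma card_chambers : D.chambers.card = n ^ 2 := by
  have e : D.chambers = (Finset.Icc 1 n).image (fun k => (k, 0)) ∪
      Finset.univ.image (fun t : Fin D.crossings.length =>
        (D.crossings[t].height, (t : ℕ) + 1)) := by
    ext ⟨k, t⟩
    rw [mem_chambers]
    simp only [Finset.mem_union, Finset.mem_image, Finset.mem_Icc, Finset.mem_univ, true_and,
      Prod.mk.injEq]
    constructor
    · rintro ⟨hk, rfl | ⟨s, hs, rfl⟩⟩
      · exact Or.inl ⟨k, hk, rfl, rfl⟩
      · exact Or.inr ⟨s, hs, rfl⟩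
    · rintro (⟨_, hk, rfl, rfl⟩ | ⟨s, rfl, rfl⟩)
      · exact ⟨hk, Or.inl rfl⟩
      · have := D.crossings[s].height_le
        exact ⟨⟨by simp [Crossing.height], by omega⟩, Or.inr ⟨s, rfl, rfl⟩⟩
  rw [e, Finset.card_union_of_disjoint, Finset.card_image_of_injective,
    Finset.card_image_of_injective, Nat.card_Icc, Finset.card_univ, Fintype.card_fin,
    length_crossings, Nat.choose_two_right, Nat.mul_div_cancel' (Nat.even_mul_pred_self n).two_dvd]
  · cases n with
    | zero => rfl
    | succ n => simp only [Nat.add_sub_cancel]; ring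
  · intro s t h
    simp only [Prod.mk.injEq] at h
    exact Fin.ext (by omega)
  · intro s t h
    simpa using h
  · rw [Finset.disjoint_left]
    simp only [Finset.mem_image, not_exists]
    rintro _ ⟨k, -, rfl⟩ t
    simp

lemma card_chamberMinors : D.chamberMinors.card = n ^ 2 := by
  rw [chamberMinors, Finset.card_image_of_injOn D.label_injOn, card_chambers]

lemma isMinorIndex_label {c : ℕ × ℕ} (hc : c ∈ D.chambers) :
    IsMinorIndex (D.label c).1 (D.label c).2 := by
  obtain ⟨k, t⟩ := c
  have hk := (D.mem_chambers.1 hc).1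
  rw [label_eq, IsMinorIndex, ← Finset.card_pos, card_lowest _ _ hk.2, card_lowest _ _ hk.2]
  exact ⟨hk.1, rfl⟩

variable {𝕜 : Type*} [RCLike 𝕜] {x : Matrix (Fin n) (Fin n) 𝕜}

lemma posState_of_chamberMinors (h : ∀ p ∈ D.chamberMinors, 0 < minor x p.1 p.2) {t : ℕ}
    (ht : t ≤ D.crossings.length) : PosState x (stateAt D.crossings t) := by
  intro k hk
  rcases Nat.eq_zero_or_pos k with rfl | hk0
  · rw [lowest_zero, lowest_zero, minor_empty]
    exact zero_lt_one
  · obtain ⟨c, hc, hl⟩ := D.exists_chamber hk0 hk ht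
    have := h _ (Finset.mem_image_of_mem D.label hc)
    rwa [hl] at this

/-- The chamber minors of a double wiring diagram form a criterion for total positivity. -/
theorem isTotallyPositive_iff : IsTotallyPositive x ↔
    ∀ p ∈ D.chamberMinors, 0 < minor x p.1 p.2 := by
  constructor
  · intro hx p hp
    obtain ⟨c, hc, rfl⟩ := Finset.mem_image.1 hp
    exact hx _ _ (D.isMinorIndex_label hc)
  · intro h
    -- Here d counts the crossings still to come; the positive path is built from the right end
    -- backwards.
    have key : ∀ d ≤ D.crossings.length,
        HasPosPath x d (stateAt D.crossings (D.crossings.length - d)) := by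
      intro d
      induction d with
      | zero => exact fun _ => .final (D.posState_of_chamberMinors h le_rfl) D.not_allowed_end
      | succ d ih =>
        intro hd
        have hlt : D.crossings.length - (d + 1) < D.crossings.length := by omega
        refine .move (D.posState_of_chamberMinors h hlt.le) (D.allowed ⟨_, hlt⟩) ?_
        have := ih (by omega)
        rw [show D.crossings.length - d = D.crossings.length - (d + 1) + 1 by omega,
          stateAt_succ _ hlt] at this
        exact this
    have := key _ le_rfl
    rw [Nat.sub_self, stateAt_zero] at this
    exact isTotallyPositive_of_posState this.posState_of_start

end DoubleWiringDiagram

/-! ### The lexicographically minimal diagram -/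

section Paths

variable {n : ℕ}

/-- The intersections of the list are allowed and lead from one state to the other through states
with the property `Q`. -/
inductive AllowedPath (Q : State n → Prop) : State n → List (Crossing n) → State n → Prop
  | nil {σ : State n} : Q σ → AllowedPath Q σ [] σ
  | cons {σ τ : State n} {c : Crossing n} {w : List (Crossing n)} :
      Q σ → Allowed σ c → AllowedPath Q (step σ c) w τ → AllowedPath Q σ (c :: w) τ

namespace AllowedPath

variable {Q : State n → Prop} {σ τ ρ : State n} {w w' : List (Crossing n)}

lemma append (h : AllowedPath Q σ w τ) (h' : AllowedPath Q τ w' ρ) :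
    AllowedPath Q σ (w ++ w') ρ := by
  induction h with
  | nil _ => exact h'
  | cons hq ha _ ih => exact .cons hq ha (ih h')

lemma foldl_eq (h : AllowedPath Q σ w τ) : w.foldl step σ = τ := by
  induction h with
  | nil _ => rfl
  | cons _ _ _ ih => exact ih

lemma prop_foldl_take (h : AllowedPath Q σ w τ) (t : ℕ) : Q ((w.take t).foldl step σ) := by
  induction h generalizing t with
  | nil hq => simpa using hq
  | cons hq _ _ ih =>
    cases t with
    | zero => exact hq
    | succ t => exact ih t

lemma allowed_foldl_take (h : AllowedPath Q σ w τ) {t : ℕ} (ht : t < w.length) :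
    Allowed ((w.take t).foldl step σ) w[t] := by
  induction h generalizing t with
  | nil _ => simp at ht
  | cons _ ha _ ih =>
    cases t with
    | zero => exact ha
    | succ t => exact ih (by simpa using ht)

end AllowedPath

lemma stateAt_eq_foldl (w : List (Crossing n)) {t : ℕ} (ht : t ≤ w.length) :
    stateAt w t = (w.take t).foldl step (startOrder n) := by
  induction t with
  | zero => simp [stateAt_zero]
  | succ t ih =>
    rw [stateAt_succ w ht, ih (by omega), List.take_succ_eq_append_getElem ht, List.foldl_append]
    rfl

/-- An inversion persists: crossings of other pairs do not affect it, and any allowed crossing of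
this pair would again leave it inverted. It is what makes a second meeting impossible. -/
lemma stateAt_order_of_crossed {w : List (Crossing n)}
    (hal : ∀ t : Fin w.length, Allowed (stateAt w t) w[t]) {a : Colour} {p q : Fin n}
    (hpq : startOrder n a p < startOrder n a q) {r : Fin w.length} (ha : w[r].colour = a)
    (hr : crossedPair w r = s(p, q)) {t : ℕ} (hrt : (r : ℕ) + 1 ≤ t) (ht : t ≤ w.length) :
    (stateAt w t a).symm q < (stateAt w t a).symm p := by
  induction t, hrt using Nat.le_induction with
  | base => exact (stateAt_succ_order (hal r) ha hr hpq).1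
  | succ t hrt ih =>
    by_cases h : w[t].colour = a ∧ crossedPair w ⟨t, ht⟩ = s(p, q)
    · exact (stateAt_succ_order (hal ⟨t, ht⟩) h.1 h.2 hpq).1
    · refine (stateAt_order_iff w (s := t) (a := a) (p := q) (q := p) ?_ (by omega) ht ?_).2
        (ih (by omega))
      · rintro rfl
        exact lt_irrefl _ hpq
      · intro r' h1 h2 hc
        have : r' = ⟨t, ht⟩ := Fin.ext (by simp only; omega)
        subst this
        exact h ⟨hc.1, hc.2.trans Sym2.eq_swap⟩

/-- A word of allowed intersections which reverses the order of all lines is a diagram. -/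
lemma existsUnique_crossing {w : List (Crossing n)}
    (hal : ∀ t : Fin w.length, Allowed (stateAt w t) w[t])
    (hend : ∀ a p q, startOrder n a p < startOrder n a q →
      (stateAt w w.length a).symm q < (stateAt w w.length a).symm p)
    (a : Colour) (p q : Fin n) (hpq : p ≠ q) :
    ∃! t : Fin w.length, w[t].colour = a ∧ crossedPair w t = s(p, q) := by
  wlog hlt : startOrder n a p < startOrder n a q generalizing p q
  · rw [Sym2.eq_swap]
    exact this q p hpq.symm (lt_of_le_of_ne (not_lt.1 hlt) fun h =>
      hpq ((startOrder n a).injective h).symm)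
  have hex : ∃ t : Fin w.length, w[t].colour = a ∧ crossedPair w t = s(p, q) := by
    by_contra! hno
    have := stateAt_order_iff w hpq (Nat.zero_le w.length) le_rfl
      fun r _ _ hc => hno r hc.1 hc.2
    rw [stateAt_zero_order_iff] at this
    exact lt_asymm (this.2 hlt) (hend a p q hlt)
  have huniq : ∀ r t : Fin w.length, (w[r].colour = a ∧ crossedPair w r = s(p, q)) →
      (w[t].colour = a ∧ crossedPair w t = s(p, q)) → ¬ r < t := by
    intro r t hr ht hrt
    exact lt_asymm (stateAt_order_of_crossed hal hlt hr.1 hr.2 hrt t.isLt.le)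
      (stateAt_succ_order (hal t) ht.1 ht.2 hlt).2
  obtain ⟨t, ht⟩ := hex
  refine ⟨t, ht, fun r hr => ?_⟩
  exact le_antisymm (not_lt.1 (huniq t r ht hr)) (not_lt.1 (huniq r t hr ht))

end Paths

/-! ### The sweep of one colour and the initial minors -/

section InitialMinors

variable {n : ℕ}

/-- All minors visible in the state are initial. -/
def InitialState (σ : State n) : Prop :=
  ∀ k, 1 ≤ k → k ≤ n → IsInitial (lowest σ .light k) (lowest σ .dark k)

/-- The k distinct lines have initial levels in an interval of k elements and so fill it; for light
lines the numbering reflects the interval. -/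
lemma exists_lowest_eq_Icc {σ : State n} {a : Colour} {k s : ℕ} (hk : 1 ≤ k) (hkn : k ≤ n)
    (hs : s + k ≤ n) (h : ∀ i : Fin n, (i : ℕ) < k →
      s ≤ (startOrder n a (σ a i) : ℕ) ∧ (startOrder n a (σ a i) : ℕ) < s + k) :
    ∃ u v : Fin n, lowest σ a k = Finset.Icc u v := by
  have key : ∀ u v : Fin n, (v : ℕ) + 1 = u + k →
      (∀ i : Fin n, (i : ℕ) < k → u ≤ σ a i ∧ σ a i ≤ v) → lowest σ a k = Finset.Icc u v := by
    intro u v huv hi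
    refine Finset.eq_of_subset_of_card_le ?_ ?_
    · intro j hj
      obtain ⟨i, hik, rfl⟩ := Finset.mem_image.1 hj
      exact Finset.mem_Icc.2 (hi i (Finset.mem_filter.1 hik).2)
    · rw [card_lowest _ _ hkn, Fin.card_Icc]
      omega
  cases a
  · refine ⟨⟨n - (s + k), by omega⟩, ⟨n - 1 - s, by omega⟩, key _ _ (by simp only; omega) ?_⟩
    intro i hi
    have := h i hi
    simp only [startOrder, Fin.revPerm_apply, Fin.val_rev] at this
    simp only [Fin.le_def]
    omega
  · refine ⟨⟨s, by omega⟩, ⟨s + k - 1, by omega⟩, key _ _ (by simp only; omega) ?_⟩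
    intro i hi
    have := h i hi
    simp only [startOrder, Equiv.Perm.one_apply] at this
    simp only [Fin.le_def]
    omega

/-- While one colour sweeps, the other has the identity arrangement, so its lowest k lines are the
first k indices and provide both an interval and the first index. -/
lemma initialState_of_one {σ : State n} {a : Colour} (h1 : σ a.other = 1)
    (h : ∀ k, 1 ≤ k → k ≤ n → ∃ u v : Fin n, lowest σ a k = Finset.Icc u v) :
    InitialState σ := by
  intro k hk hkn
  have hmem : (⟨0, by omega⟩ : Fin n) ∈ lowest σ a.other k := by
    have := (mem_lowest (σ := σ) (a := a.other) (k := k) (i := ⟨0, by omega⟩)).2 (by simp only; omega)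
    rwa [h1] at this
  have hIcc : ∃ u v : Fin n, lowest σ a.other k = Finset.Icc u v := by
    refine ⟨⟨0, by omega⟩, ⟨k - 1, by omega⟩, ?_⟩
    ext j
    have := (mem_lowest (σ := σ) (a := a.other) (k := k) (i := j))
    rw [h1, Equiv.Perm.one_apply] at this
    rw [this, Finset.mem_Icc]
    simp only [Fin.le_def]
    omega
  have hm : IsMinorIndex (lowest σ .light k) (lowest σ .dark k) := by
    rw [IsMinorIndex, ← Finset.card_pos, card_lowest _ _ hkn, card_lowest _ _ hkn]
    exact ⟨hk, rfl⟩
  cases a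
  · exact ⟨hm, h k hk hkn, hIcc, _, Finset.mem_union_right _ hmem, rfl⟩
  · exact ⟨hm, hIcc, h k hk hkn, _, Finset.mem_union_left _ hmem, rfl⟩

/-- The initial level of the line at level `i` when, in the block `m + 1, …, 2, 1` of
intersections, the line from level `m + 1` has moved down to level `p`. -/
def sweepRank (m p i : ℕ) : ℕ :=
  if i < p then m - i else if i = p then m + 1 else if i ≤ m + 1 then m + 1 - i else i

/-- The lines of colour `a` are in the positions described by `sweepRank m p`. -/
def SweepState (a : Colour) (m p : ℕ) (σ : State n) : Prop :=
  ∀ i : Fin n, (startOrder n a (σ a i) : ℕ) = sweepRank m p i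

lemma SweepState.initialState {a : Colour} {m p : ℕ} {σ : State n} (h : SweepState a m p σ)
    (h1 : σ a.other = 1) (hp : p ≤ m + 1) (hm : m ≤ n - 1) (hmp : m + 1 < n ∨ p = m + 1) :
    InitialState σ := by
  refine initialState_of_one h1 fun k hk hkn => ?_
  -- The lowest k initial levels run up to m if the moving line is not among them (k ≤ p), up to m +
  -- 1 if it is and k ≤ m + 2, and are all levels below k otherwise.
  have hs : ∃ s, s + k ≤ n ∧ ∀ i < k, s ≤ sweepRank m p i ∧ sweepRank m p i < s + k := by
    by_cases h1 : k ≤ p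
    · refine ⟨m + 1 - k, by omega, fun i hi => ?_⟩
      unfold sweepRank
      split_ifs <;> omega
    · by_cases h2 : k ≤ m + 2
      · refine ⟨m + 2 - k, by omega, fun i hi => ?_⟩
        unfold sweepRank
        split_ifs <;> omega
      · refine ⟨0, by omega, fun i hi => ?_⟩
        unfold sweepRank
        split_ifs <;> omega
  obtain ⟨s, hs, hsi⟩ := hs
  exact exists_lowest_eq_Icc hk hkn hs fun i hi => h i ▸ hsi i hi

lemma SweepState.allowed {a : Colour} {m : ℕ} {p : Fin (n - 1)} {σ : State n}
    (h : SweepState a m (p + 1) σ) : Allowed σ ⟨a, p⟩ := by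
  have h1 := h (Crossing.mk a p).lower
  have h2 := h (Crossing.mk a p).upper
  rw [Allowed, Fin.lt_def]
  simp only at h1 h2 ⊢
  rw [h1, h2]
  simp [sweepRank, Crossing.lower, Crossing.upper]

lemma SweepState.step {a : Colour} {m : ℕ} {p : Fin (n - 1)} {σ : State n}
    (h : SweepState a m (p + 1) σ) (hp : (p : ℕ) ≤ m) : SweepState a m p (step σ ⟨a, p⟩) := by
  intro i
  have e : TotalPositivity.step σ ⟨a, p⟩ a i =
      σ a (Equiv.swap (Crossing.mk a p).lower (Crossing.mk a p).upper i) := by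
    rw [show TotalPositivity.step σ ⟨a, p⟩ a = _ from step_apply_self σ ⟨a, p⟩]
    rfl
  rw [e, h, Equiv.swap_apply_def]
  simp only [Fin.ext_iff, Crossing.lower, Crossing.upper, sweepRank]
  split_ifs <;> simp_all <;> omega

/-- In the reversed block the largest position comes first, so this isolates the next crossing of
the sweep. -/
lemma filter_finRange_lt_succ {N p : ℕ} (hp : p < N) :
    (List.finRange N).filter (fun i : Fin N => (i : ℕ) < p + 1) =
      (List.finRange N).filter (fun i : Fin N => (i : ℕ) < p) ++ [⟨p, hp⟩] := by
  have key : ∀ q ≤ N, ((List.finRange N).filter (fun i : Fin N => (i : ℕ) < q)).map Fin.val =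
      List.range q := by
    intro q hq
    have h1 : ((List.finRange N).filter (fun i : Fin N => (i : ℕ) < q)).map Fin.val =
        ((List.finRange N).map Fin.val).filter (· < q) := by
      rw [List.filter_map]
      rfl
    rw [h1, List.map_coe_finRange_eq_range]
    refine List.Perm.eq_of_pairwise (le := (· < ·)) ?_ ?_ ?_ ?_
    · intro a b _ _ h h'
      omega
    · exact List.pairwise_lt_range.filter _
    · exact List.pairwise_lt_range
    · refine (List.perm_ext_iff_of_nodup (List.nodup_range.filter _) List.nodup_range).2 ?_
      intro a
      simp
      omega
  apply List.map_injective_iff.2 Fin.val_injective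
  rw [key _ (by omega), List.map_append, key _ (by omega), List.range_succ]
  rfl

lemma AllowedPath.block {a : Colour} {m : ℕ} (hm : m + 1 < n) {p : ℕ} (hp : p ≤ m + 1)
    {σ : State n} (h : SweepState a m p σ) (h1 : σ a.other = 1) :
    ∃ τ : State n, AllowedPath InitialState σ
      ((((List.finRange (n - 1)).filter fun i : Fin (n - 1) => (i : ℕ) < p).reverse).map (Crossing.mk a)) τ ∧
      SweepState a m 0 τ ∧ τ a.other = 1 := by
  have hI : InitialState σ := h.initialState h1 hp (by omega) (Or.inl hm)
  induction p generalizing σ with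
  | zero => exact ⟨σ, by simpa using AllowedPath.nil hI, h, h1⟩
  | succ p ih =>
    have hpn : p < n - 1 := by omega
    have h' : SweepState a m p (step σ ⟨a, ⟨p, hpn⟩⟩) :=
      SweepState.step (p := ⟨p, hpn⟩) h (by simp only; omega)
    have h1' : step σ ⟨a, ⟨p, hpn⟩⟩ a.other = 1 := by
      rw [step_apply_of_ne _ _ (Colour.other_ne a), h1]
    obtain ⟨τ, hτ, h2⟩ := ih (by omega) h' h1' (h'.initialState h1' (by omega) (by omega) (Or.inl hm))
    refine ⟨τ, ?_, h2⟩
    rw [filter_finRange_lt_succ hpn, List.reverse_append]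
    exact .cons hI (SweepState.allowed (p := ⟨p, hpn⟩) h) hτ

/-- All intersections of one colour, in the lexicographically minimal order. -/
lemma AllowedPath.sweep {a : Colour} {σ : State n} (h : σ a = startOrder n a)
    (h1 : σ a.other = 1) : ∃ τ : State n,
      AllowedPath InitialState σ ((lexMinPositions n).map (Crossing.mk a)) τ ∧
      (∀ i : Fin n, (startOrder n a (τ a i) : ℕ) = n - 1 - i) ∧ τ a.other = 1 := by
  have h0 : SweepState a 0 1 σ := by
    intro i
    rw [h, ← Equiv.Perm.mul_apply, startOrder_mul_self, Equiv.Perm.one_apply]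
    unfold sweepRank
    split_ifs <;> omega
  have key : ∀ M ≤ n - 1, ∃ τ : State n, AllowedPath InitialState σ
      ((((List.finRange (n - 1)).take M).flatMap fun m =>
        ((List.finRange (n - 1)).filter (· ≤ m)).reverse).map (Crossing.mk a)) τ ∧
      SweepState a M (M + 1) τ ∧ τ a.other = 1 := by
    intro M
    induction M with
    | zero =>
      exact fun _ => ⟨σ, by
        simpa using AllowedPath.nil (h0.initialState h1 (by omega) (by omega) (Or.inr rfl)), h0, h1⟩
    | succ M ih =>
      intro hM
      obtain ⟨τ, hτ, h2, h3⟩ := ih (by omega)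
      obtain ⟨ρ, hρ, h4, h5⟩ := AllowedPath.block (by omega) le_rfl h2 h3
      refine ⟨ρ, ?_, ?_, h5⟩
      · rw [List.take_succ_eq_append_getElem (by simpa using hM), List.flatMap_append,
          List.map_append]
        refine hτ.append ?_
        simp only [List.flatMap_cons, List.flatMap_nil, List.append_nil, List.getElem_finRange]
        convert hρ using 5 with i
        simp [Fin.le_def]
      -- When the moving line has arrived at the bottom, the lowest M + 2 lines are completely
      -- reversed, which is also the starting position of the next block.
      · intro i
        rw [h4 i]
        unfold sweepRank
        split_ifs <;> omega
  obtain ⟨τ, hτ, h2, h3⟩ := key (n - 1) le_rfl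
  rw [List.take_of_length_le (by simp)] at hτ
  refine ⟨τ, hτ, fun i => ?_, h3⟩
  have := i.isLt
  rw [h2 i]
  unfold sweepRank
  split_ifs <;> omega

lemma AllowedPath.lexMin : ∃ τ : State n,
    AllowedPath InitialState (startOrder n) (lexMinCrossings n) τ ∧
      ∀ (a : Colour) (i : Fin n), (startOrder n a (τ a i) : ℕ) = n - 1 - i := by
  obtain ⟨τ, h1, h2, h3⟩ := AllowedPath.sweep (a := .light) (σ := startOrder n) rfl rfl
  -- Reversing the light lines, which start as n, …, 1, gives the identity, as the dark sweep
  -- requires of the other colour.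
  have h4 : τ .light = 1 := by
    ext i
    have := h2 i
    have := i.isLt
    have := (τ .light i).isLt
    simp only [startOrder, Fin.revPerm_apply, Fin.val_rev] at *
    simp only [Equiv.Perm.one_apply]
    omega
  obtain ⟨ρ, h5, h6, h7⟩ := AllowedPath.sweep (a := .dark) (σ := τ) h3 h4
  refine ⟨ρ, h1.append h5, fun a i => ?_⟩
  cases a
  · have : ρ .light = 1 := h7
    rw [this]
    simp only [startOrder, Equiv.Perm.one_apply, Fin.revPerm_apply, Fin.val_rev]
    omega
  · exact h6 i

open Classical in
lemma card_isInitial_le :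
    ((Finset.univ : Finset (Finset (Fin n) × Finset (Fin n))).filter
      fun p => IsInitial p.1 p.2).card ≤ n ^ 2 := by
  -- An initial minor is determined by the last indices b and d: since one of the two intervals
  -- starts at 0 and both have the same length, this length is min b d + 1.
  let f : Fin n × Fin n → Finset (Fin n) × Finset (Fin n) := fun p =>
    (Finset.Icc ⟨p.1 - min (p.1 : ℕ) p.2, by omega⟩ p.1,
      Finset.Icc ⟨p.2 - min (p.1 : ℕ) p.2, by omega⟩ p.2)
  have hsub : (Finset.univ.filter fun p : Finset (Fin n) × Finset (Fin n) =>
      IsInitial p.1 p.2) ⊆ Finset.univ.image f := by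
    rintro ⟨I, J⟩ h
    obtain ⟨⟨hne, hcard⟩, ⟨a, b, rfl⟩, ⟨c, d, rfl⟩, i, hi, hi0⟩ := (Finset.mem_filter.1 h).2
    dsimp only at hne hcard hi
    rw [Fin.card_Icc, Fin.card_Icc] at hcard
    rw [Finset.nonempty_Icc, Fin.le_def] at hne
    rw [Finset.mem_union, Finset.mem_Icc, Finset.mem_Icc, Fin.le_def, Fin.le_def, Fin.le_def,
      Fin.le_def] at hi
    refine Finset.mem_image.2 ⟨(b, d), Finset.mem_univ _, ?_⟩
    have h1 : (⟨b - min (b : ℕ) d, by omega⟩ : Fin n) = a := Fin.ext (by simp only; omega)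
    have h2 : (⟨d - min (b : ℕ) d, by omega⟩ : Fin n) = c := Fin.ext (by simp only; omega)
    simp only [f, h1, h2]
  refine (Finset.card_le_card hsub).trans (Finset.card_image_le.trans ?_)
  simp [sq]

/-- The chamber minors of the lexicographically minimal diagram are the initial minors. -/
theorem exists_lexMin_diagram (n : ℕ) : ∃ D : DoubleWiringDiagram n,
    D.crossings = lexMinCrossings n ∧
      ∀ I J : Finset (Fin n), (I, J) ∈ D.chamberMinors ↔ IsInitial I J := by
  classical
  obtain ⟨τ, hτ, hend⟩ := AllowedPath.lexMin (n := n)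
  have hfinal : stateAt (lexMinCrossings n) (lexMinCrossings n).length = τ := by
    rw [stateAt_eq_foldl _ le_rfl, List.take_length, hτ.foldl_eq]
  let D : DoubleWiringDiagram n := ⟨lexMinCrossings n, existsUnique_crossing
    (fun t => by rw [stateAt_eq_foldl _ t.isLt.le]; exact hτ.allowed_foldl_take t.isLt)
    (fun a p q hpq => by
      rw [hfinal]
      have hp := hend a ((τ a).symm p)
      have hq := hend a ((τ a).symm q)
      rw [Equiv.apply_symm_apply] at hp hq
      rw [Fin.lt_def] at hpq ⊢
      omega)⟩
  have hsub : D.chamberMinors ⊆ (Finset.univ.filter fun p : Finset (Fin n) × Finset (Fin n) =>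
      IsInitial p.1 p.2) := by
    intro p hp
    obtain ⟨⟨k, t⟩, hc, rfl⟩ := Finset.mem_image.1 hp
    have hk := D.mem_chambers.1 hc
    have ht : t ≤ (lexMinCrossings n).length := by
      rcases hk.2 with rfl | ⟨s, -, rfl⟩
      · exact Nat.zero_le _
      · exact s.isLt
    refine Finset.mem_filter.2 ⟨Finset.mem_univ _, ?_⟩
    have := hτ.prop_foldl_take t k hk.1.1 hk.1.2
    rwa [← stateAt_eq_foldl _ ht] at this
  -- The chamber minors are n² initial minors, and there are at most n² of those, so the inclusion
  -- is an equality.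
  have heq := Finset.eq_of_subset_of_card_le hsub (by
    rw [D.card_chamberMinors]; exact card_isInitial_le)
  exact ⟨D, rfl, fun I J => by rw [heq]; simp⟩

end InitialMinors

end TotalPositivity

theorem mainTheorem4 {𝕜 : Type*} [RCLike 𝕜] (n : ℕ) :
    -- every double wiring diagram has `n²` chambers with distinct chamber minors,
    -- and their positivity is a criterion for total positivity
    (∀ D : TotalPositivity.DoubleWiringDiagram n,
      D.chambers.card = n ^ 2 ∧ D.chamberMinors.card = n ^ 2 ∧
      ∀ x : Matrix (Fin n) (Fin n) 𝕜,
        TotalPositivity.IsTotallyPositive x ↔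
          ∀ p ∈ D.chamberMinors, 0 < TotalPositivity.minor x p.1 p.2) ∧
    -- optimality: no criterion of this kind uses fewer than `n²` minors
    (∀ S : Finset (Finset (Fin n) × Finset (Fin n)),
      (∀ p ∈ S, TotalPositivity.IsMinorIndex p.1 p.2) →
      (∀ x : Matrix (Fin n) (Fin n) 𝕜,
        TotalPositivity.IsTotallyPositive x ↔ ∀ p ∈ S, 0 < TotalPositivity.minor x p.1 p.2) →
      n ^ 2 ≤ S.card) ∧
    -- the chamber minors of the lexicographically minimal diagram are the initial minors
    (∃ D : TotalPositivity.DoubleWiringDiagram n,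
      D.crossings = TotalPositivity.lexMinCrossings n ∧
      ∀ I J : Finset (Fin n), (I, J) ∈ D.chamberMinors ↔ TotalPositivity.IsInitial I J) := by
  refine ⟨fun D => ⟨D.card_chambers, D.card_chamberMinors, fun x => D.isTotallyPositive_iff⟩,
    fun S hS hcrit => TotalPositivity.card_le_of_criterion S hS hcrit,
    TotalPositivity.exists_lexMin_diagram n⟩
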